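/- Let $L$ be a (possibly many-sorted) first-order language with set of sorts $S$, and let $T$ be a complete $L$-theory with NIP. Let $M\models T$ and let $M\prec N$ be a sufficiently saturated elementary extension ($\mu$-saturated for some $\mu>\aleph_0+|S|+|L|+|M|$). Let $P$ be a new unary predicate (one for each sort, in the many-sorted case), regard the pair $(N,M)$ as the $L\cup\{P\}$-structure expanding $N$ with $P(N)=M$, and let $(N,M)\prec(N',M')$ be a sufficiently saturated elementary extension of $L\cup\{P\}$-structures, $P(N')=M'$ ($\kappa$-saturated for some $\kappa>\aleph_0+|S|+|L|+|N|$). Call a set small if its cardinality is less than $\kappa$. Let $A=(a_i)_{i\in I}$ be a small non-constant $L$-indiscernible sequence of tuples from $M'$, indexed by a linear order, all of the same finite sequence of sorts. Then there is a small $L$-indiscernible sequence $A'=(a'_j)_{j\in J}$ of tuples from $M'$ which extends $A$ (that is, there is an order embedding $e:I\to J$ with $a'_{e(i)}=a_i$ for all $i\in I$) and which has the following property. For every $n$ and every complete $L$-type $q(\bar x)$ over $A'$ in $\bar x=(x_1,\dots,x_n)$, each $x_i$ being a tuple of variables of the sorts of the members of $A$: if $q$ is finitely realised in $A'$ (every finite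 subset of $q$ is realised by an $n$-tuple of members of $A'$), then $q(\bar x)\cup\{P(x_1),\dots,P(x_n)\}$ implies a complete $L$-type over $N$, i.e. there is a complete $L$-type $r(\bar x)$ over $N$ such that every $\bar v$ in $N'$ which realises $q$ and has all its coordinates in $M'$ realises $r$. -/

import Mathlib

open Cardinal

universe u x

/-- A many-sorted first-order language with set of sorts `S`. A function symbol has finitely many
input sorts and an output sort, a relation symbol has finitely many input sorts; constants are the
function symbols without inputs. One-sorted logic is the case where `S` has one element. -/
structure MSLanguage (S : Type u) where
  /-- function symbols with given number of arguments, argument sorts and value sort -/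
  Functions : (n : ℕ) → (Fin n → S) → S → Type u
  /-- relation symbols with given number of arguments and argument sorts -/
  Relations : (n : ℕ) → (Fin n → S) → Type u

namespace MSLanguage

variable {S : Type u}

/-- The number of symbols of the language. -/
noncomputable def card (L : MSLanguage S) : Cardinal.{u} :=
  #((Σ (n : ℕ) (d : Fin n → S) (s : S), L.Functions n d s) ⊕
    (Σ (n : ℕ) (d : Fin n → S), L.Relations n d))

/-! ### Syntax -/

/-- Terms whose variables are the elements of `α`, the variable `a` being of sort `σ a`. -/
inductive Term (L : MSLanguage S) {α : Type x} (σ : α → S) : S → Type (max u x)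
  | var (a : α) : Term L σ (σ a)
  | func {n : ℕ} {d : Fin n → S} {s : S} (f : L.Functions n d s)
      (ts : ∀ i, Term L σ (d i)) : Term L σ s

/-- First-order formulas with free variables in `α` (sorted by `σ`) and with further variables
`0, …, n-1` (sorted by `τ`), which are available for quantification: the quantifier `all s` binds
the variable `0`, of sort `s`, of its argument. -/
inductive BoundedFormula (L : MSLanguage S) {α : Type x} (σ : α → S) :
    (n : ℕ) → (Fin n → S) → Type (max u x)
  | falsum {n : ℕ} {τ : Fin n → S} : BoundedFormula L σ n τ
  | equal {n : ℕ} {τ : Fin n → S} {s : S} (t₁ t₂ : Term L (Sum.elim σ τ) s) :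
      BoundedFormula L σ n τ
  | rel {n : ℕ} {τ : Fin n → S} {k : ℕ} {d : Fin k → S} (R : L.Relations k d)
      (ts : ∀ i, Term L (Sum.elim σ τ) (d i)) : BoundedFormula L σ n τ
  | imp {n : ℕ} {τ : Fin n → S} (φ ψ : BoundedFormula L σ n τ) : BoundedFormula L σ n τ
  | all {n : ℕ} {τ : Fin n → S} (s : S)
      (φ : BoundedFormula L σ (n + 1) (Fin.cons s τ : Fin (n + 1) → S)) : BoundedFormula L σ n τ

/-- Formulas with free variables in `α`, sorted by `σ`. -/
abbrev Formula (L : MSLanguage S) {α : Type x} (σ : α → S) : Type (max u x) :=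
  BoundedFormula L σ 0 Fin.elim0

/-- Negation. -/
def Formula.not {L : MSLanguage S} {α : Type x} {σ : α → S} (φ : L.Formula σ) : L.Formula σ :=
  BoundedFormula.imp φ BoundedFormula.falsum

/-- Formulas without free variables. -/
abbrev Sentence (L : MSLanguage S) : Type u :=
  L.Formula (Empty.elim : Empty → S)

/-- A theory is a set of sentences. -/
abbrev Theory (L : MSLanguage S) : Type u :=
  Set L.Sentence

/-! ### Structures and truth -/

/-- A structure for a many-sorted language. -/
structure Str (L : MSLanguage S) where
  /-- the underlying set of each sort -/
  carrier : S → Type u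
  /-- interpretation of the function symbols -/
  funMap : ∀ {n : ℕ} {d : Fin n → S} {s : S},
    L.Functions n d s → (∀ i, carrier (d i)) → carrier s
  /-- interpretation of the relation symbols -/
  relMap : ∀ {n : ℕ} {d : Fin n → S}, L.Relations n d → (∀ i, carrier (d i)) → Prop

variable {L : MSLanguage S}

/-- An assignment on a disjoint union of two sets of variables, put together from two parts. -/
def Str.glue (M : L.Str) {α β : Type*} {σ : α → S} {τ : β → S}
    (v : ∀ a, M.carrier (σ a)) (w : ∀ b, M.carrier (τ b)) :
    ∀ c : α ⊕ β, M.carrier (Sum.elim σ τ c)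
  | .inl a => v a
  | .inr b => w b

/-- The value of a term under an assignment. -/
def Term.realize (M : L.Str) {α : Type x} {σ : α → S} (v : ∀ a, M.carrier (σ a)) :
    ∀ {s : S}, Term L σ s → M.carrier s
  | _, .var a => v a
  | _, .func f ts => M.funMap f (fun i => (ts i).realize M v)

/-- Truth of a formula under assignments `v`, `w`. -/
def BoundedFormula.realize (M : L.Str) {α : Type x} {σ : α → S} (v : ∀ a, M.carrier (σ a)) :
    ∀ {n : ℕ} {τ : Fin n → S}, BoundedFormula L σ n τ → (∀ i, M.carrier (τ i)) → Prop
  | _, _, .falsum, _ => False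
  | _, _, .equal t₁ t₂, w => t₁.realize M (M.glue v w) = t₂.realize M (M.glue v w)
  | _, _, .rel R ts, w => M.relMap R (fun i => (ts i).realize M (M.glue v w))
  | _, _, .imp φ ψ, w => φ.realize M v w → ψ.realize M v w
  | _, τ, .all s φ, w => ∀ b : M.carrier s,
      φ.realize M v
        (Fin.cons (α := fun i => M.carrier ((Fin.cons s τ : Fin _ → S) i)) b w)

/-- Truth of a formula under the assignment `v` of its free variables. -/
def Formula.Realize {α : Type x} {σ : α → S} (φ : L.Formula σ) (M : L.Str)
    (v : ∀ a, M.carrier (σ a)) : Prop :=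
  BoundedFormula.realize M v φ (fun i => i.elim0)

/-- `M` is a model of `T`. -/
def Str.Models (M : L.Str) (T : L.Theory) : Prop :=
  ∀ φ ∈ T, Formula.Realize φ M (fun e => e.elim)

/-- `T` decides every sentence. -/
def Theory.IsComplete (T : L.Theory) : Prop :=
  ∀ φ : L.Sentence, (∀ M : L.Str, M.Models T → φ.Realize M (fun e => e.elim)) ∨
    (∀ M : L.Str, M.Models T → φ.not.Realize M (fun e => e.elim))

/-- `T` has NIP: for every partitioned formula `φ(x; y)` there is some `n` such that in no model of
`T` a sequence of `n` tuples is shattered by `φ`. -/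
def Theory.IsNIP (T : L.Theory) : Prop :=
  ∀ (k l : ℕ) (σ : Fin k → S) (τ : Fin l → S) (φ : L.Formula (Sum.elim σ τ)),
    ∃ n : ℕ, ∀ M : L.Str, M.Models T →
      ¬ ∃ (a : Fin n → ∀ i, M.carrier (σ i)) (b : Set (Fin n) → ∀ j, M.carrier (τ j)),
        ∀ (i : Fin n) (s : Set (Fin n)), φ.Realize M (M.glue (a i) (b s)) ↔ i ∈ s

/-- Elementary embeddings. -/
structure ElementaryEmbedding (M N : L.Str) where
  /-- the underlying map on each sort -/
  toFun : ∀ s, M.carrier s → N.carrier s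
  /-- truth of formulas is preserved in both directions -/
  map_formula : ∀ {n : ℕ} {σ : Fin n → S} (φ : L.Formula σ) (v : ∀ i, M.carrier (σ i)),
    φ.Realize N (fun i => toFun (σ i) (v i)) ↔ φ.Realize M v

/-- The image of an elementary embedding, a subset of each sort. -/
def ElementaryEmbedding.range {M N : L.Str} (f : ElementaryEmbedding M N) :
    ∀ s, Set (N.carrier s) :=
  fun s => Set.range (f.toFun s)

/-! ### Pairs -/

/-- For each sort one unary predicate symbol. -/
inductive PredSymbol : (n : ℕ) → (Fin n → S) → Type u
  | P (s : S) : PredSymbol 1 (fun _ => s)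

/-- The language `L ∪ {P}`, where `P` consists of a new unary predicate for each sort. -/
def withP (L : MSLanguage S) : MSLanguage S where
  Functions := L.Functions
  Relations n d := L.Relations n d ⊕ PredSymbol n d

/-- The `L ∪ {P}`-structure which expands `N` by interpreting `P` as the given subset of each
sort. -/
def Str.pair (N : L.Str) (P : ∀ s, Set (N.carrier s)) : L.withP.Str where
  carrier := N.carrier
  funMap := fun f v => Str.funMap (L := L) N f v
  relMap := fun R v =>
    match R, v with
    | .inl R, v => N.relMap R v
    | .inr (.P s), v => v 0 ∈ P s

/-! ### Types and saturation -/

/-- The elements of a structure (of all sorts). -/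
abbrev Str.Elem (M : L.Str) : Type u := Σ s, M.carrier s

/-- The elements in a family of subsets of the sorts. -/
def Str.elems (M : L.Str) (P : ∀ s, Set (M.carrier s)) : Set M.Elem :=
  {e | e.2 ∈ P e.1}

/-- `L`-formulas with parameters in the set `A` of elements of `M`, with variables in `α` sorted
by `σ`. -/
abbrev Str.FormulaOver (M : L.Str) (A : Set M.Elem) {α : Type x} (σ : α → S) : Type (max u x) :=
  L.Formula (Sum.elim σ (fun a : A => a.1.1))

/-- Truth in `M` of a formula with parameters in `A`. -/
def Str.Holds (M : L.Str) {A : Set M.Elem} {α : Type x} {σ : α → S} (φ : M.FormulaOver A σ)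
    (v : ∀ a, M.carrier (σ a)) : Prop :=
  φ.Realize M (M.glue v (fun a : A => a.1.2))

/-- The tuple `v` realises the set `p` of formulas. -/
def Str.Realises (M : L.Str) {A : Set M.Elem} {α : Type x} {σ : α → S}
    (v : ∀ a, M.carrier (σ a)) (p : Set (M.FormulaOver A σ)) : Prop :=
  ∀ φ ∈ p, M.Holds φ v

/-- Every finite subset of `p` is realised in `M` by a tuple from the set `X`. -/
def Str.FinitelyRealisedIn (M : L.Str) {A : Set M.Elem} {α : Type x} {σ : α → S}
    (p : Set (M.FormulaOver A σ)) (X : Set (∀ a, M.carrier (σ a))) : Prop :=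
  ∀ p₀ ⊆ p, p₀.Finite → ∃ v ∈ X, M.Realises v p₀

/-- `p` is a complete type over `A`: it is consistent with the theory of `M` with names for the
elements of `A`, and contains each formula over `A` or its negation. -/
def Str.IsCompleteType (M : L.Str) (A : Set M.Elem) {α : Type x} {σ : α → S}
    (p : Set (M.FormulaOver A σ)) : Prop :=
  M.FinitelyRealisedIn p Set.univ ∧ ∀ φ : M.FormulaOver A σ, φ ∈ p ∨ Formula.not φ ∈ p

/-- `κ`-saturation: every type in finitely many variables over fewer than `κ` parameters is
realised. -/
def Str.IsSaturated (M : L.Str) (κ : Cardinal.{u}) : Prop :=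
  ∀ A : Set M.Elem, #A < κ → ∀ (n : ℕ) (σ : Fin n → S) (p : Set (M.FormulaOver A σ)),
    M.FinitelyRealisedIn p Set.univ → ∃ v, M.Realises v p

/-! ### Indiscernible sequences -/

section Sequences

variable (M : L.Str) {m : ℕ} {σ : Fin m → S} {I : Type u}

/-- For a sequence `a` of tuples of the sorts `σ 0, …, σ (m-1)` and indices `f 0, …, f (n-1)`, the
`n`-tuple `(a (f 0), …, a (f (n-1)))`. It is an assignment for `n` tuples of variables of the
same sorts. -/
def Str.tuple (a : I → ∀ k, M.carrier (σ k)) {n : ℕ} (f : Fin n → I) :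
    ∀ p : Fin n × Fin m, M.carrier (σ p.2) :=
  fun p => a (f p.1) p.2

/-- `a` is an `L`-indiscernible sequence in `M`. -/
def Str.IsIndiscernible [LinearOrder I] (a : I → ∀ k, M.carrier (σ k)) : Prop :=
  ∀ (n : ℕ) (φ : L.Formula (fun p : Fin n × Fin m => σ p.2)) (f g : Fin n → I),
    StrictMono f → StrictMono g → (φ.Realize M (M.tuple a f) ↔ φ.Realize M (M.tuple a g))

/-- The elements that occur as coordinates of a member of the sequence. -/
def Str.coords (a : I → ∀ k, M.carrier (σ k)) : Set M.Elem :=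
  {e | ∃ (i : I) (k : Fin m), e = ⟨σ k, a i k⟩}

end Sequences

end MSLanguage

/-! The sequence `A` is extended inside `M'` in such a way that formulas with parameters from `N`
behave tamely along the extension. For such a formula `φ(x₁, …, xₙ)` and members `x < y` of a
sequence, `φ` *jumps* between `x` and `y` if its truth value at some `n`-tuple of members changes
when `x` is replaced by `y`, where no other entry of the tuple lies between `x` and `y` (`Jump`).
If there were many non-overlapping jumps, then some large set of them would be independent of each
other (`HasJumps.exists_independent`). By indiscernibility the two sides of these jumps could be
exchanged at will, so that `φ`, with its parameters as further variables, would shatter a large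
set. Hence NIP bounds the number of non-overlapping jumps, uniformly in the sequence
(`exists_jump_bound`).

Therefore some small extension in `M'` has, for all these formulas at once, as
many non-overlapping jumps as any further extension (`JumpStable`). Among its extensions some has,
moreover, as many jumps between an element and its successor as possible, where such pairs once
present are to remain without elements in between (`GapStable`). In the result `R` no limit jumps
(`not_jump_of_stable`): let `v`, in an extension of `R`, be a limit from below of elements `z` of
`R`, such that `φ` jumps between `v` and all `z` close to `v`. As the number of jumps is maximal,
one of them surrounds `v`, and all of it is concentrated in the cut of `v`: if part of it were
left above `v`, then it would be two jumps. Now saturation of the pair `(N', M')` yields a limit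
in `M'` from below in this cut and, if needed, one from above. These have no jumps towards the
elements of `R` close to them, because infinitely many jumps would follow (`LimExt.not_jump`). So
`φ` jumps between the two limits (or between the limit from below and the least element above it),
which are adjacent. This is a new jump at a successor, a contradiction.

Finally let a complete type over the coordinates of `R` be finitely realised in `R`, hence be the
limit of types of tuples `f` of members of `R` along an ultrafilter. If `v` is a realisation in
`M'`, then its members can be inserted into the indiscernible sequence (`exists_insert`); for
almost all `f` the tuples `f` and `v` have the same order type, and no jump separates their
corresponding members. So `f` can be moved to `v`, one member at a time, without a change of the
truth value of `φ` (`iff_of_not_jump`). Thus `v` realises the limit of types over `N` along the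
ultrafilter, which does not depend on `v`.

Throughout, sequences are given by the linear orders on their sets of members, as relations `R`
whose field is `{a | R a a}`, so that extension of sequences becomes `R ≤ R'`. -/

universe y

namespace MSLanguage

variable {S : Type u} {L : MSLanguage S}

/-! ### Substitution -/

/-- Simultaneous substitution of terms for the variables of a term. -/
def Term.subst {α : Type x} {β : Type y} {σ : α → S} {ρ : β → S} (t : ∀ a, Term L ρ (σ a)) :
    ∀ {s : S}, Term L σ s → Term L ρ s
  | _, .var a => t a
  | _, .func f ts => .func f (fun i => (ts i).subst t)

theorem Term.realize_subst (M : L.Str) {α : Type x} {β : Type y} {σ : α → S} {ρ : β → S}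
    (t : ∀ a, Term L ρ (σ a)) (v : ∀ b, M.carrier (ρ b)) {s : S} (r : Term L σ s) :
    (r.subst t).realize M v = r.realize M (fun a => (t a).realize M v) := by
  induction r with
  | var a => rfl
  | func f ts ih => simp only [Term.subst, Term.realize, ih]

/-- The effect on terms of binding one more variable: the bound variables move up by one. -/
def Term.shift {α : Type x} {σ : α → S} {n : ℕ} {τ : Fin n → S} (s : S) {r : S}
    (t : Term L (Sum.elim σ τ) r) :
    Term L (Sum.elim σ (Fin.cons s τ : Fin (n + 1) → S)) r :=
  t.subst (fun c => match c with
    | .inl a => .var (σ := Sum.elim σ (Fin.cons s τ : Fin (n + 1) → S)) (.inl a)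
    | .inr i => .var (σ := Sum.elim σ (Fin.cons s τ : Fin (n + 1) → S)) (.inr i.succ))

theorem Term.realize_shift (M : L.Str) {α : Type x} {σ : α → S} {n : ℕ} {τ : Fin n → S} (s : S)
    {r : S} (t : Term L (Sum.elim σ τ) r) (v : ∀ a, M.carrier (σ a)) (w : ∀ i, M.carrier (τ i))
    (b : M.carrier s) :
    (t.shift s).realize M (M.glue v (τ := (Fin.cons s τ : Fin (n + 1) → S))
      (Fin.cons (α := fun i => M.carrier ((Fin.cons s τ : Fin _ → S) i)) b w)) =
      t.realize M (M.glue v w) := by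
  rw [Term.shift, Term.realize_subst]
  congr 1
  funext c
  rcases c with a | i <;> rfl

/-- The terms to be substituted below a quantifier. -/
def substUnder {α : Type x} {β : Type y} {σ : α → S} {ρ : β → S} {n k : ℕ} {τ : Fin n → S}
    {τ' : Fin k → S} (s : S) (t : ∀ c, Term L (Sum.elim ρ τ') (Sum.elim σ τ c)) :
    ∀ c, Term L (Sum.elim ρ (Fin.cons s τ' : Fin (k + 1) → S))
      (Sum.elim σ (Fin.cons s τ : Fin (n + 1) → S) c)
  | .inl a => (t (.inl a)).shift s
  | .inr i => Fin.cases
      (motive := fun i => Term L (Sum.elim ρ (Fin.cons s τ' : Fin (k + 1) → S))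
        ((Fin.cons s τ : Fin (n + 1) → S) i))
      (.var (σ := Sum.elim ρ (Fin.cons s τ' : Fin (k + 1) → S)) (.inr 0))
      (fun i => (t (.inr i)).shift s) i

/-- Simultaneous substitution of terms for the free variables and for those bound variables which
are not quantified in the formula. -/
def BoundedFormula.subst {α : Type x} {β : Type y} {σ : α → S} {ρ : β → S} :
    ∀ {n : ℕ} {τ : Fin n → S} {k : ℕ} {τ' : Fin k → S}, BoundedFormula L σ n τ →
      (∀ c, Term L (Sum.elim ρ τ') (Sum.elim σ τ c)) → BoundedFormula L ρ k τ'
  | _, _, _, _, .falsum, _ => .falsum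
  | _, _, _, _, .equal t₁ t₂, t => .equal (t₁.subst t) (t₂.subst t)
  | _, _, _, _, .rel R ts, t => .rel R (fun i => (ts i).subst t)
  | _, _, _, _, .imp φ ψ, t => .imp (φ.subst t) (ψ.subst t)
  | _, _, _, _, .all s φ, t => .all s (φ.subst (substUnder s t))

theorem BoundedFormula.realize_subst (M : L.Str) {α : Type x} {β : Type y} {σ : α → S}
    {ρ : β → S} {n : ℕ} {τ : Fin n → S} (φ : BoundedFormula L σ n τ) :
    ∀ {k : ℕ} {τ' : Fin k → S} (t : ∀ c, Term L (Sum.elim ρ τ') (Sum.elim σ τ c))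
      (v : ∀ b, M.carrier (ρ b)) (w : ∀ i, M.carrier (τ' i)),
      (φ.subst t).realize M v w ↔
        φ.realize M (fun a => (t (.inl a)).realize M (M.glue v w))
          (fun i => (t (.inr i)).realize M (M.glue v w)) := by
  have glue_eq : ∀ {n : ℕ} {τ : Fin n → S} {k : ℕ} {τ' : Fin k → S}
      (t : ∀ c, Term L (Sum.elim ρ τ') (Sum.elim σ τ c))
      (v : ∀ b, M.carrier (ρ b)) (w : ∀ i, M.carrier (τ' i)),
      (fun c => (t c).realize M (M.glue v w)) =
        M.glue (fun a => (t (.inl a)).realize M (M.glue v w))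
          (fun i => (t (.inr i)).realize M (M.glue v w)) := by
    intro n τ k τ' t v w
    funext c
    rcases c with a | i <;> rfl
  induction φ with
  | falsum => intros; rfl
  | equal t₁ t₂ =>
    intro k τ' t v w
    simp only [BoundedFormula.subst, BoundedFormula.realize, Term.realize_subst, glue_eq]
    rfl
  | rel R ts =>
    intro k τ' t v w
    simp only [BoundedFormula.subst, BoundedFormula.realize, Term.realize_subst, glue_eq]
    rfl
  | imp φ ψ ih₁ ih₂ =>
    intro k τ' t v w
    simp only [BoundedFormula.subst, BoundedFormula.realize, ih₁, ih₂]
  | all s φ ih =>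
    intro k τ' t v w
    simp only [BoundedFormula.subst, BoundedFormula.realize, ih]
    refine forall_congr' fun b => ?_
    apply Eq.to_iff
    congr 1
    · funext a
      exact Term.realize_shift M s (t (.inl a)) v w b
    · funext i
      refine Fin.cases ?_ (fun i => ?_) i
      · rfl
      · exact Term.realize_shift M s (t (.inr i)) v w b

/-- Substitution of terms for the free variables of a formula. -/
def Formula.substFree {α : Type x} {β : Type y} {σ : α → S} {ρ : β → S} (φ : L.Formula σ)
    (t : ∀ a, Term L ρ (σ a)) : L.Formula ρ :=
  BoundedFormula.subst φ (τ' := Fin.elim0) (fun c => match c with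
    | .inl a => (t a).subst (fun b => .var (σ := Sum.elim ρ Fin.elim0) (.inl b))
    | .inr i => i.elim0)

theorem Formula.realize_substFree (M : L.Str) {α : Type x} {β : Type y} {σ : α → S} {ρ : β → S}
    (φ : L.Formula σ) (t : ∀ a, Term L ρ (σ a)) (v : ∀ b, M.carrier (ρ b)) :
    (φ.substFree t).Realize M v ↔ φ.Realize M (fun a => (t a).realize M v) := by
  rw [Formula.Realize, Formula.substFree, BoundedFormula.realize_subst]
  apply Eq.to_iff
  rw [Formula.Realize]
  congr 1
  · funext a
    exact Term.realize_subst M _ _ _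
  · funext i
    exact i.elim0

/-! ### Definable sets of assignments -/

/-- The set `D` of assignments is defined in `M` by a formula without parameters. -/
def Str.Dfn (M : L.Str) {α : Type x} (σ : α → S) (D : (∀ a, M.carrier (σ a)) → Prop) : Prop :=
  ∃ φ : L.Formula σ, ∀ v, φ.Realize M v ↔ D v

namespace Str.Dfn

variable {M : L.Str} {α : Type x} {σ : α → S} {D E : (∀ a, M.carrier (σ a)) → Prop}

theorem congr (h : M.Dfn σ D) (hDE : ∀ v, D v ↔ E v) : M.Dfn σ E :=
  h.imp fun _ hφ v => (hφ v).trans (hDE v)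

theorem imp (hD : M.Dfn σ D) (hE : M.Dfn σ E) : M.Dfn σ (fun v => D v → E v) := by
  obtain ⟨φ, hφ⟩ := hD
  obtain ⟨ψ, hψ⟩ := hE
  exact ⟨.imp φ ψ, fun v => imp_congr (hφ v) (hψ v)⟩

theorem false : M.Dfn σ (fun _ => False) := ⟨.falsum, fun _ => Iff.rfl⟩

theorem not (hD : M.Dfn σ D) : M.Dfn σ (fun v => ¬ D v) := hD.imp false

theorem and (hD : M.Dfn σ D) (hE : M.Dfn σ E) : M.Dfn σ (fun v => D v ∧ E v) :=
  (hD.imp hE.not).not.congr fun v => by tauto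

theorem forall_finite {ν : Type*} [Finite ν] {D : ν → (∀ a, M.carrier (σ a)) → Prop}
    (h : ∀ i, M.Dfn σ (D i)) : M.Dfn σ (fun v => ∀ i, D i v) := by
  classical
  have := Fintype.ofFinite ν
  have key : ∀ s : Finset ν, M.Dfn σ (fun v => ∀ i ∈ s, D i v) := by
    intro s
    induction s using Finset.induction_on with
    | empty => exact false.not.congr fun v => by simp
    | insert a s _ ih => exact ((h a).and ih).congr fun v => by simp
  exact (key Finset.univ).congr fun v => by simp

theorem equal (M : L.Str) {s : S} (t₁ t₂ : Term L σ s) :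
    M.Dfn σ (fun v => t₁.realize M v = t₂.realize M v) := by
  refine ⟨.equal (t₁.subst fun b => .var (σ := Sum.elim σ Fin.elim0) (.inl b))
    (t₂.subst fun b => .var (σ := Sum.elim σ Fin.elim0) (.inl b)), fun v => ?_⟩
  have key : ∀ t : Term L σ s, (t.subst fun b => .var (σ := Sum.elim σ Fin.elim0) (.inl b)).realize
      M (M.glue v fun i : Fin 0 => i.elim0) = t.realize M v := fun t => Term.realize_subst M _ _ t
  exact Eq.congr (key t₁) (key t₂)

theorem preimage {β : Type y} {ρ : β → S} (hD : M.Dfn σ D) (t : ∀ a, Term L ρ (σ a)) :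
    M.Dfn ρ (fun v => D (fun a => (t a).realize M v)) :=
  hD.elim fun φ hφ => ⟨φ.substFree t, fun v => (φ.realize_substFree M t v).trans (hφ _)⟩

theorem exists_one {s : S} {D : (∀ a, M.carrier (σ a)) → M.carrier s → Prop}
    (h : M.Dfn (Sum.elim σ fun _ : Unit => s)
      (fun v => D (fun a => v (.inl a)) (v (.inr ())))) :
    M.Dfn σ (fun v => ∃ b, D v b) := by
  have hall : ∀ {D : (∀ a, M.carrier (σ a)) → M.carrier s → Prop},
      M.Dfn (Sum.elim σ fun _ : Unit => s) (fun v => D (fun a => v (.inl a)) (v (.inr ()))) →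
      M.Dfn σ (fun v => ∀ b, D v b) := by
    rintro D ⟨φ, hφ⟩
    refine ⟨.all s (BoundedFormula.subst φ (fun c => match c with
      | .inl (.inl a) => .var (σ := Sum.elim σ (Fin.cons s Fin.elim0 : Fin 1 → S)) (.inl a)
      | .inl (.inr ()) => .var (σ := Sum.elim σ (Fin.cons s Fin.elim0 : Fin 1 → S)) (.inr 0)
      | .inr i => i.elim0)), fun v => forall_congr' fun b => ?_⟩
    rw [BoundedFormula.realize_subst]
    refine Iff.trans (Eq.to_iff ?_) (hφ (M.glue v (fun _ => b)))
    rw [Formula.Realize]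
    congr 1
    · funext a
      rcases a with a | a <;> rfl
    · funext i
      exact i.elim0
  exact (hall (D := fun v b => ¬ D v b) h.not).not.congr fun v => by simp

theorem exists_fin {l : ℕ} : ∀ {α : Type x} {σ : α → S} {τ : Fin l → S}
    {D : (∀ a, M.carrier (σ a)) → (∀ j, M.carrier (τ j)) → Prop},
    M.Dfn (Sum.elim σ τ) (fun v => D (fun a => v (.inl a)) (fun j => v (.inr j))) →
    M.Dfn σ (fun v => ∃ w, D v w) := by
  induction l with
  | zero =>
    intro α σ τ D h
    have := h.preimage (ρ := σ) (fun c => match c with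
      | .inl a => .var a
      | .inr i => i.elim0)
    refine this.congr fun v => ⟨fun h => ⟨_, h⟩, ?_⟩
    rintro ⟨w, hw⟩
    refine cast ?_ hw
    congr 1
    funext i
    exact i.elim0
  | succ l ih =>
    intro α σ τ D h
    have h1 : M.Dfn (Sum.elim σ fun _ : Unit => τ 0)
        (fun v => ∃ w : ∀ j : Fin l, M.carrier (τ j.succ),
          D (fun a => v (Sum.inl a))
            (Fin.cons (α := fun i => M.carrier (τ i)) (v (Sum.inr ())) w)) := by
      refine ih (τ := fun j => τ j.succ)
        (D := fun (v : ∀ c, M.carrier (Sum.elim σ (fun _ : Unit => τ 0) c)) w =>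
          D (fun a => v (Sum.inl a))
            (Fin.cons (α := fun i => M.carrier (τ i)) (v (Sum.inr ())) w)) ?_
      let t : ∀ c : α ⊕ Fin (l + 1), Term L
          (Sum.elim (Sum.elim σ fun _ : Unit => τ 0) fun j : Fin l => τ j.succ)
          (Sum.elim σ τ c) := fun c =>
        match c with
        | Sum.inl a => .var (σ := Sum.elim (Sum.elim σ fun _ : Unit => τ 0)
              fun j : Fin l => τ j.succ) (Sum.inl (Sum.inl a))
        | Sum.inr i => Fin.cases (motive := fun i => Term L
              (Sum.elim (Sum.elim σ fun _ : Unit => τ 0) fun j : Fin l => τ j.succ) (τ i))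
              (.var (σ := Sum.elim (Sum.elim σ fun _ : Unit => τ 0)
                fun j : Fin l => τ j.succ) (Sum.inl (Sum.inr ())))
              (fun j => .var (σ := Sum.elim (Sum.elim σ fun _ : Unit => τ 0)
                fun j : Fin l => τ j.succ) (Sum.inr j)) i
      have := h.preimage t
      refine this.congr fun v => Eq.to_iff ?_
      congr 1
      funext i
      refine Fin.cases ?_ (fun i => ?_) i <;> rfl
    refine (exists_one (D := fun v b => ∃ w : ∀ j : Fin l, M.carrier (τ j.succ),
      D v (Fin.cons (α := fun i => M.carrier (τ i)) b w)) h1).congr fun v => ?_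
    constructor
    · rintro ⟨b, w, h⟩
      exact ⟨_, h⟩
    · rintro ⟨w, h⟩
      refine ⟨w 0, fun j => w j.succ, ?_⟩
      convert h using 1
      exact Fin.cons_self_tail w

end Str.Dfn

/-! ### Finite support -/

theorem Term.exists_finset (L : MSLanguage S) {α : Type x} {β : Type y} {σ : α → S} {ρ : β → S}
    {s : S} (t : Term L (Sum.elim σ ρ) s) :
    ∃ F : Finset α, ∀ F' : Finset α, F ⊆ F' →
      ∃ t' : Term L (Sum.elim (fun a : F' => σ a) ρ) s, ∀ (M : L.Str)
        (v : ∀ a, M.carrier (σ a)) (w : ∀ b, M.carrier (ρ b)),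
        t.realize M (M.glue v w) = t'.realize M (M.glue (fun a : F' => v a) w) := by
  classical
  induction t with
  | var c =>
    rcases c with a | b
    · exact ⟨{a}, fun F' hF => ⟨.var (σ := Sum.elim (fun a : F' => σ a) ρ)
        (.inl ⟨a, hF (by simp)⟩), fun M v w => rfl⟩⟩
    · exact ⟨∅, fun F' hF => ⟨.var (σ := Sum.elim (fun a : F' => σ a) ρ) (.inr b),
        fun M v w => rfl⟩⟩
  | func f ts ih =>
    choose F hF using ih
    refine ⟨Finset.univ.biUnion F, fun F' hF' => ?_⟩
    choose t' ht' using fun i => hF i F'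
      ((Finset.subset_biUnion_of_mem F (Finset.mem_univ i)).trans hF')
    exact ⟨.func f t', fun M v w => by simp only [Term.realize, ht']⟩

theorem BoundedFormula.exists_finset {α : Type x} {σ : α → S} {n : ℕ} {τ : Fin n → S}
    (φ : BoundedFormula L σ n τ) :
    ∃ F : Finset α, ∀ F' : Finset α, F ⊆ F' →
      ∃ ψ : BoundedFormula L (fun a : F' => σ a) n τ, ∀ (M : L.Str)
        (v : ∀ a, M.carrier (σ a)) (w : ∀ b, M.carrier (τ b)),
        φ.realize M v w ↔ ψ.realize M (fun a : F' => v a) w := by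
  classical
  induction φ with
  | falsum => exact ⟨∅, fun F' _ => ⟨.falsum, fun M v w => Iff.rfl⟩⟩
  | equal t₁ t₂ =>
    obtain ⟨F₁, h₁⟩ := t₁.exists_finset
    obtain ⟨F₂, h₂⟩ := t₂.exists_finset
    refine ⟨F₁ ∪ F₂, fun F' hF => ?_⟩
    obtain ⟨t₁', h₁⟩ := h₁ F' (Finset.union_subset_left hF)
    obtain ⟨t₂', h₂⟩ := h₂ F' (Finset.union_subset_right hF)
    exact ⟨.equal t₁' t₂', fun M v w => by simp only [BoundedFormula.realize, h₁, h₂]⟩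
  | rel R ts =>
    choose F hF using fun i => (ts i).exists_finset
    refine ⟨Finset.univ.biUnion F, fun F' hF' => ?_⟩
    choose t' ht' using fun i => hF i F'
      ((Finset.subset_biUnion_of_mem F (Finset.mem_univ i)).trans hF')
    exact ⟨.rel R t', fun M v w => by simp only [BoundedFormula.realize, ht']⟩
  | imp φ ψ ih₁ ih₂ =>
    obtain ⟨F₁, h₁⟩ := ih₁
    obtain ⟨F₂, h₂⟩ := ih₂
    refine ⟨F₁ ∪ F₂, fun F' hF => ?_⟩
    obtain ⟨φ', h₁⟩ := h₁ F' (Finset.union_subset_left hF)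
    obtain ⟨ψ', h₂⟩ := h₂ F' (Finset.union_subset_right hF)
    exact ⟨.imp φ' ψ', fun M v w => imp_congr (h₁ M v w) (h₂ M v w)⟩
  | all s φ ih =>
    obtain ⟨F, hF⟩ := ih
    refine ⟨F, fun F' hF' => ?_⟩
    obtain ⟨φ', h⟩ := hF F' hF'
    exact ⟨.all s φ', fun M v w => forall_congr' fun b => h M v _⟩

/-- A formula has only finitely many parameters. -/
theorem Formula.exists_fin_params {α : Type x} {β : Type y} {σ : α → S} {ρ : β → S}
    (φ : L.Formula (Sum.elim σ ρ)) :
    ∃ (l : ℕ) (g : Fin l → β) (ψ : L.Formula (Sum.elim σ (fun j => ρ (g j)))),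
      ∀ (M : L.Str) (v : ∀ a, M.carrier (σ a)) (w : ∀ b, M.carrier (ρ b)),
        φ.Realize M (M.glue v w) ↔ ψ.Realize M (M.glue v (fun j => w (g j))) := by
  classical
  obtain ⟨F, hF⟩ := BoundedFormula.exists_finset φ
  obtain ⟨ψ, hψ⟩ := hF F subset_rfl
  let G : Finset β := F.preimage Sum.inr (Sum.inr_injective.injOn)
  let e := G.equivFin.symm
  have ht : ∀ c : F, ∃ t : Term L (Sum.elim σ (fun j => ρ (e j).1)) (Sum.elim σ ρ c.1),
      ∀ (M : L.Str) (v : ∀ a, M.carrier (σ a)) (w : ∀ b, M.carrier (ρ b)),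
        t.realize M (M.glue v (fun j => w (e j).1)) = M.glue v w c.1 := by
    rintro ⟨a | b, hc⟩
    · exact ⟨.var (σ := Sum.elim σ (fun j => ρ (e j).1)) (.inl a), fun M v w => rfl⟩
    · obtain ⟨j, hj⟩ := e.surjective ⟨b, by simpa [G] using hc⟩
      obtain rfl : (e j).1 = b := by rw [hj]
      exact ⟨.var (σ := Sum.elim σ (fun j => ρ (e j).1)) (.inr j), fun M v w => rfl⟩
  choose t ht using ht
  refine ⟨_, fun j => (e j).1, Formula.substFree ψ t, fun M v w => ?_⟩
  rw [Formula.realize_substFree]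
  simp only [ht]
  exact hψ M _ _

/-! ### Formulas of the language of pairs -/

/-- A term of `L`, read in `L ∪ {P}`. -/
def Term.toP {α : Type x} {σ : α → S} : ∀ {s : S}, Term L σ s → Term L.withP σ s
  | _, .var a => .var a
  | _, .func f ts => .func (L := L.withP) f (fun i => (ts i).toP)

/-- A formula of `L`, read in `L ∪ {P}`. -/
def BoundedFormula.toP {α : Type x} {σ : α → S} :
    ∀ {n : ℕ} {τ : Fin n → S}, BoundedFormula L σ n τ → BoundedFormula L.withP σ n τ
  | _, _, .falsum => .falsum
  | _, _, .equal t₁ t₂ => .equal t₁.toP t₂.toP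
  | _, _, .rel R ts => .rel (L := L.withP) (.inl R) (fun i => (ts i).toP)
  | _, _, .imp φ ψ => .imp φ.toP ψ.toP
  | _, _, .all s φ => .all s φ.toP

theorem Term.realize_toP (N : L.Str) (P : ∀ s, Set (N.carrier s)) {α : Type x} {σ : α → S}
    (v : ∀ a, N.carrier (σ a)) {s : S} (t : Term L σ s) :
    t.toP.realize (N.pair P) v = t.realize N v := by
  induction t with
  | var a => rfl
  | func f ts ih =>
    simp only [Term.toP, Term.realize, ih]
    rfl

theorem BoundedFormula.realize_toP (N : L.Str) (P : ∀ s, Set (N.carrier s)) {α : Type x}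
    {σ : α → S} (v : ∀ a, N.carrier (σ a)) {n : ℕ} {τ : Fin n → S} (φ : BoundedFormula L σ n τ) :
    ∀ w : ∀ i, N.carrier (τ i), φ.toP.realize (N.pair P) v w ↔ φ.realize N v w := by
  have glue_eq : ∀ {n : ℕ} {τ : Fin n → S} (w : ∀ i, N.carrier (τ i)),
      Str.glue (N.pair P) (σ := σ) v w = N.glue v w := by
    intro n τ w
    funext c
    rcases c with a | i <;> rfl
  have ht : ∀ {n : ℕ} {τ : Fin n → S} (w : ∀ i, N.carrier (τ i)) {s : S}
      (t : Term L (Sum.elim σ τ) s),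
      t.toP.realize (N.pair P) (Str.glue (N.pair P) (σ := σ) v w) = t.realize N (N.glue v w) := by
    intro n τ w s t
    rw [glue_eq, Term.realize_toP]
  induction φ with
  | falsum => exact fun _ => Iff.rfl
  | equal t₁ t₂ => exact fun w => Eq.congr (ht w t₁) (ht w t₂)
  | rel R ts =>
    intro w
    change N.relMap R _ ↔ N.relMap R _
    simp only [ht]
  | imp φ ψ ih₁ ih₂ => exact fun w => imp_congr (ih₁ w) (ih₂ w)
  | all s φ ih => exact fun w => forall_congr' fun b => ih _

theorem Formula.realize_toP (N : L.Str) (P : ∀ s, Set (N.carrier s)) {α : Type x}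
    {σ : α → S} (v : ∀ a, N.carrier (σ a)) (φ : L.Formula σ) :
    Formula.Realize (L := L.withP) (BoundedFormula.toP φ) (N.pair P) v ↔ φ.Realize N v :=
  BoundedFormula.realize_toP N P v φ _

theorem ElementaryEmbedding.models {M N : L.Str} (f : ElementaryEmbedding M N) {T : L.Theory}
    (hM : M.Models T) : N.Models T := by
  intro φ hφ
  have h := f.map_formula (σ := (Fin.elim0 : Fin 0 → S)) (φ.substFree fun e => e.elim)
    (fun i => i.elim0)
  rw [Formula.realize_substFree, Formula.realize_substFree] at h
  convert h.2 (by convert hM φ hφ)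

theorem ElementaryEmbedding.models_of_pair {N N' : L.Str} {P : ∀ s, Set (N.carrier s)}
    {P' : ∀ s, Set (N'.carrier s)} (f : ElementaryEmbedding (N.pair P) (N'.pair P'))
    {T : L.Theory} (hN : N.Models T) : N'.Models T := by
  let T' : L.withP.Theory := Set.image (fun φ : L.Sentence => BoundedFormula.toP φ) T
  have h : (N'.pair P').Models T' := by
    refine f.models ?_
    rintro _ ⟨φ, hφ, rfl⟩
    refine cast ?_ ((Formula.realize_toP N P (fun e : Empty => e.elim) φ).2 (hN φ hφ))
    congr 1
  intro φ hφ
  refine (Formula.realize_toP N' P' (fun e : Empty => e.elim) φ).1 (cast ?_ (h _ ⟨φ, hφ, rfl⟩))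
  congr 1

/-! ### The number of formulas -/

theorem mk_sigma_term_le {α : Type u} (σ : α → S) {c : Cardinal.{u}} (hc : ℵ₀ ≤ c)
    (hL : L.card ≤ c) (hα : #α ≤ c) : #(Σ s, Term L σ s) ≤ c := by
  let A := α ⊕ (Σ (n : ℕ) (d : Fin n → S) (s : S), L.Functions n d s)
  let B : A → Type := fun a => match a with
    | .inl _ => Empty
    | .inr f => Fin f.1
  have hA : #A ≤ c := by
    rw [Cardinal.mk_sum, Cardinal.lift_id, Cardinal.lift_id]
    refine Cardinal.add_le_of_le hc hα (le_trans ?_ hL)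
    exact Cardinal.mk_le_of_injective Sum.inl_injective
  let F : ∀ s, Term L σ s → WType B := fun s t =>
    Term.rec (motive := fun _ _ => WType B) (fun a => ⟨.inl a, Empty.elim⟩)
      (fun {n d s} f _ ih => ⟨.inr ⟨n, d, s, f⟩, ih⟩) t
  have hF : ∀ (s : S) (t : Term L σ s) (s' : S) (t' : Term L σ s'), F s t = F s' t' →
      (⟨s, t⟩ : Σ s, Term L σ s) = ⟨s', t'⟩ := by
    intro s t
    induction t with
    | var a =>
      intro s' t' h
      cases t' with
      | var b =>
        simp only [F, WType.mk.injEq] at h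
        cases h.1
        rfl
      | func f ts => simp [F] at h
    | func f ts ih =>
      intro s' t' h
      cases t' with
      | var b => simp [F] at h
      | func g us =>
        simp only [F, WType.mk.injEq] at h
        obtain ⟨h1, h2⟩ := h
        cases h1
        have : ts = us := funext fun i => by
          have := ih i _ (us i) (congrFun (eq_of_heq h2) i)
          simpa using this
        rw [this]
  refine (Cardinal.mk_le_of_injective (f := fun t : Σ s, Term L σ s => F t.1 t.2)
    fun t t' h => hF _ _ _ _ h).trans ?_
  have : ∀ a, Finite (B a) := by
    rintro (a | f)
    · exact inferInstanceAs (Finite Empty)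
    · exact inferInstanceAs (Finite (Fin f.1))
  exact WType.cardinalMk_le_max_aleph0_of_finite'.trans (max_le (by simpa using hA) hc)

theorem mk_list_le {α : Type u} {c : Cardinal.{u}} (hc : ℵ₀ ≤ c) (hα : #α ≤ c) : #(List α) ≤ c :=
  (Cardinal.mk_list_le_max α).trans (max_le hc hα)

theorem mk_sigma_fin_le {α : Type u} {c : Cardinal.{u}} (hc : ℵ₀ ≤ c) (hα : #α ≤ c) :
    #(Σ n : ℕ, Fin n → α) ≤ c := by
  refine (Cardinal.mk_le_of_injective (f := fun p : Σ n : ℕ, Fin n → α => List.ofFn p.2)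
    fun p q h => ?_).trans (mk_list_le hc hα)
  exact List.ofFn_inj'.1 h

/-- The number of formulas is at most the maximum of the numbers of symbols, sorts, variables
and `ℵ₀`. -/
theorem mk_formula_le {α : Type u} (σ : α → S) {c : Cardinal.{u}} (hc : ℵ₀ ≤ c) (hS : #S ≤ c)
    (hL : L.card ≤ c) (hα : #α ≤ c) : #(L.Formula σ) ≤ c := by
  let X := Σ n : ℕ, Fin n → S
  have hX : #X ≤ c := mk_sigma_fin_le hc hS
  let Tm := Σ i : X, Σ s, Term L (Sum.elim σ i.2) s
  have hTm : #Tm ≤ c := by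
    rw [Cardinal.mk_sigma]
    refine (Cardinal.sum_le_mk_mul_iSup _).trans (Cardinal.mul_le_of_le hc hX ?_)
    refine ciSup_le' fun i => mk_sigma_term_le _ hc hL ?_
    rw [Cardinal.mk_sum, Cardinal.lift_uzero]
    exact Cardinal.add_le_of_le hc hα (by simpa using (Cardinal.natCast_lt_aleph0.le.trans hc))
  let Rl := Σ (n : ℕ) (d : Fin n → S), L.Relations n d
  have hRl : #Rl ≤ c := le_trans (Cardinal.mk_le_of_injective Sum.inr_injective) hL
  let A := X ⊕ (Tm × Tm) ⊕ (X × Rl × List Tm) ⊕ X ⊕ (X × S)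
  let B : A → Type := fun a => match a with
    | .inl _ => Empty
    | .inr (.inl _) => Empty
    | .inr (.inr (.inl _)) => Empty
    | .inr (.inr (.inr (.inl _))) => Bool
    | .inr (.inr (.inr (.inr _))) => Unit
  have hA : #A ≤ c := by
    simp only [A, Cardinal.mk_sum, Cardinal.mk_prod, Cardinal.lift_id]
    have hl := mk_list_le hc hTm
    refine Cardinal.add_le_of_le hc hX (Cardinal.add_le_of_le hc (Cardinal.mul_le_of_le hc hTm hTm)
      (Cardinal.add_le_of_le hc (Cardinal.mul_le_of_le hc hX (Cardinal.mul_le_of_le hc hRl hl))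
      (Cardinal.add_le_of_le hc hX (Cardinal.mul_le_of_le hc hX hS))))
  let F : ∀ (n : ℕ) (τ : Fin n → S), BoundedFormula L σ n τ → WType B := fun n τ φ =>
    BoundedFormula.rec (motive := fun _ _ _ => WType B)
      (fun {n τ} => ⟨.inl ⟨n, τ⟩, Empty.elim⟩)
      (fun {n τ s} t₁ t₂ => ⟨.inr (.inl (⟨⟨n, τ⟩, s, t₁⟩, ⟨⟨n, τ⟩, s, t₂⟩)), Empty.elim⟩)
      (fun {n τ k d} R ts => ⟨.inr (.inr (.inl (⟨n, τ⟩, ⟨k, d, R⟩,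
        List.ofFn fun i => ⟨⟨n, τ⟩, d i, ts i⟩))), Empty.elim⟩)
      (fun {n τ} _ _ f g => ⟨.inr (.inr (.inr (.inl ⟨n, τ⟩))), fun b => cond b f g⟩)
      (fun {n τ} s _ f => ⟨.inr (.inr (.inr (.inr (⟨n, τ⟩, s)))), fun _ => f⟩) φ
  have hF : ∀ (n : ℕ) (τ : Fin n → S) (φ : BoundedFormula L σ n τ) (n' : ℕ) (τ' : Fin n' → S)
      (φ' : BoundedFormula L σ n' τ'), F n τ φ = F n' τ' φ' →
      (⟨⟨n, τ⟩, φ⟩ : Σ i : X, BoundedFormula L σ i.1 i.2) = ⟨⟨n', τ'⟩, φ'⟩ := by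
    intro n τ φ
    induction φ with
    | falsum =>
      intro n' τ' φ' h
      cases φ' with
      | falsum =>
        simp only [F, WType.mk.injEq] at h
        cases h.1
        rfl
      | _ => cases (WType.mk.inj h).1
    | equal t₁ t₂ =>
      intro n' τ' φ' h
      cases φ' with
      | equal u₁ u₂ =>
        simp only [F, WType.mk.injEq] at h
        cases h.1
        rfl
      | _ => cases (WType.mk.inj h).1
    | rel R ts =>
      intro n' τ' φ' h
      cases φ' with
      | rel R' us =>
        simp only [F, WType.mk.injEq] at h
        have h1 := Prod.ext_iff.1 (Sum.inl.inj (Sum.inr.inj (Sum.inr.inj h.1)))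
        have h2 := Prod.ext_iff.1 h1.2
        obtain ⟨h1, -⟩ := h1
        obtain ⟨h2, h3⟩ := h2
        cases h1
        cases h2
        have : ts = us := funext fun i => by
          have h4 := congrFun (List.ofFn_injective h3) i
          exact eq_of_heq (Sigma.mk.inj (eq_of_heq (Sigma.mk.inj h4).2)).2
        rw [this]
      | _ => cases (WType.mk.inj h).1
    | imp φ ψ ih₁ ih₂ =>
      intro n' τ' φ' h
      cases φ' with
      | imp φ' ψ' =>
        simp only [F, WType.mk.injEq] at h
        obtain ⟨h1, h2⟩ := h
        cases h1
        have e₁ := ih₁ _ _ φ' (congrFun (eq_of_heq h2) true)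
        have e₂ := ih₂ _ _ ψ' (congrFun (eq_of_heq h2) false)
        cases e₁
        cases e₂
        rfl
      | _ => cases (WType.mk.inj h).1
    | all s φ ih =>
      intro n' τ' φ' h
      cases φ' with
      | all s' φ' =>
        simp only [F, WType.mk.injEq] at h
        obtain ⟨h1, h2⟩ := h
        cases h1
        have e := ih _ _ φ' (congrFun (eq_of_heq h2) ())
        cases e
        rfl
      | _ => cases (WType.mk.inj h).1
  refine (Cardinal.mk_le_of_injective (f := fun φ : L.Formula σ => F 0 Fin.elim0 φ)
    fun φ φ' h => ?_).trans ?_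
  · have := hF _ _ _ _ _ _ h
    simpa using this
  have : ∀ a, Finite (B a) := by
    rintro (a | a | a | a | a)
    · exact inferInstanceAs (Finite Empty)
    · exact inferInstanceAs (Finite Empty)
    · exact inferInstanceAs (Finite Empty)
    · exact inferInstanceAs (Finite Bool)
    · exact inferInstanceAs (Finite Unit)
  exact WType.cardinalMk_le_max_aleph0_of_finite'.trans (max_le (by simpa using hA) hc)

end MSLanguage

/-! ### Linear orders on subsets -/

section Orders

open Filter

variable {T : Type u}

/-- `R` is a (reflexive) linear order on its field `{a | R a a}`. Encoding an ordered set by such a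
relation makes `R ≤ R'` say that the one is a suborder of the other. -/
structure IsLin (R : T → T → Prop) : Prop where
  left : ∀ {a b}, R a b → R a a
  right : ∀ {a b}, R a b → R b b
  trans : ∀ {a b c}, R a b → R b c → R a c
  antisymm : ∀ {a b}, R a b → R b a → a = b
  total : ∀ {a b}, R a a → R b b → R a b ∨ R b a

theorem IsLin.swap {R : T → T → Prop} (h : IsLin R) : IsLin (Function.swap R) where
  left := h.right
  right := h.left
  trans h₁ h₂ := h.trans h₂ h₁
  antisymm h₁ h₂ := h.antisymm h₂ h₁
  total h₁ h₂ := h.total h₂ h₁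

theorem IsLin.of_le {R R' : T → T → Prop} (h : IsLin R) (h' : IsLin R') (hle : R ≤ R') {a b : T}
    (ha : R a a) (hb : R b b) (hab : R' a b) : R a b := by
  rcases h.total ha hb with h1 | h1
  · exact h1
  · rwa [h'.antisymm hab (hle _ _ h1)] at ha ⊢

open Classical in
/-- The tuple `s` with `y` in place of `x`. -/
noncomputable def repl {n : ℕ} (x y : T) (s : Fin n → T) : Fin n → T :=
  fun i => if s i = x then y else s i

/-- The truth value of `Φ` at some tuple of elements of `R` changes when the element `x` of the
tuple is replaced by `y`, where `x < y` and no other element of the tuple lies between `x` and `y`.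
-/
def Jump (R : T → T → Prop) {n : ℕ} (Φ : (Fin n → T) → Prop) (x y : T) : Prop :=
  R x y ∧ x ≠ y ∧ ∃ s : Fin n → T, (∀ i, R (s i) (s i)) ∧
    (∀ i, s i = x ∨ ¬ (R x (s i) ∧ R (s i) y)) ∧ ¬ (Φ s ↔ Φ (repl x y s))

/-- There are `K` non-overlapping jumps of `Φ`. -/
def HasJumps (K : ℕ) (R : T → T → Prop) {n : ℕ} (Φ : (Fin n → T) → Prop) : Prop :=
  ∃ P : Finset (T × T), P.card = K ∧ (∀ p ∈ P, Jump R Φ p.1 p.2) ∧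
    ∀ p ∈ P, ∀ q ∈ P, p ≠ q → R p.2 q.1 ∨ R q.2 p.1

/-- `y` is the successor of `x`. -/
def Consec (R : T → T → Prop) (x y : T) : Prop :=
  R x y ∧ x ≠ y ∧ ∀ z, R x z → R z y → z = x ∨ z = y

/-- There are `K` jumps of `Φ` between an element and its successor. -/
def HasGaps (K : ℕ) (R : T → T → Prop) {n : ℕ} (Φ : (Fin n → T) → Prop) : Prop :=
  ∃ P : Finset (T × T), P.card = K ∧ ∀ p ∈ P, Jump R Φ p.1 p.2 ∧ Consec R p.1 p.2

section Jumps

variable {R R' : T → T → Prop} {n : ℕ} {Φ : (Fin n → T) → Prop} {x y z : T} {K : ℕ}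

theorem Jump.mono (hR : IsLin R) (hR' : IsLin R') (h : R ≤ R') (hj : Jump R Φ x y) :
    Jump R' Φ x y := by
  obtain ⟨hxy, hne, s, hs, hav, hΦ⟩ := hj
  refine ⟨h _ _ hxy, hne, s, fun i => h _ _ (hs i), fun i => ?_, hΦ⟩
  refine (hav i).imp_right fun hn hb => hn ⟨?_, ?_⟩
  · exact hR.of_le hR' h (hR.left hxy) (hs i) hb.1
  · exact hR.of_le hR' h (hs i) (hR.right hxy) hb.2

theorem repl_mem (hy : R y y) {s : Fin n → T} (hs : ∀ i, R (s i) (s i)) (i : Fin n) :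
    R (repl x y s i) (repl x y s i) := by
  unfold repl
  split_ifs
  · exact hy
  · exact hs i

theorem repl_repl {s : Fin n → T} (hs : ∀ i, s i = x ∨ s i ≠ y) :
    repl y z (repl x y s) = repl x z s := by
  funext i
  unfold repl
  rcases hs i with h | h <;> grind

theorem Jump.swap (hR : IsLin R) (hj : Jump R Φ x y) : Jump (Function.swap R) Φ y x := by
  obtain ⟨hxy, hne, s, hs, hav, hΦ⟩ := hj
  have hsy : ∀ i, s i = x ∨ s i ≠ y := fun i => (hav i).imp_right fun h e =>
    h ⟨by rwa [e], by rw [e]; exact hR.right hxy⟩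
  refine ⟨hxy, hne.symm, repl x y s, fun i => repl_mem (hR.right hxy) hs i, fun i => ?_, ?_⟩
  · unfold repl
    split_ifs with h
    · exact Or.inl rfl
    · exact Or.inr fun hb => ((hav i).resolve_left h) ⟨hb.2, hb.1⟩
  · rw [repl_repl hsy]
    have : repl x x s = s := by
      funext i
      unfold repl
      split_ifs with h
      · exact h.symm
      · rfl
    rw [this]
    exact fun h => hΦ h.symm

/-- A jump from `x` to `y` takes place before or after an element between them. -/
theorem Jump.split (hR : IsLin R) (hj : Jump R Φ x y) (hxz : R x z) (hzy : R z y) (h₁ : x ≠ z)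
    (h₂ : z ≠ y) : Jump R Φ x z ∨ Jump R Φ z y := by
  obtain ⟨hxy, hne, s, hs, hav, hΦ⟩ := hj
  by_cases h : Φ s ↔ Φ (repl x z s)
  · right
    refine ⟨hzy, h₂, repl x z s, fun i => repl_mem (hR.right hxz) hs i, fun i => ?_, ?_⟩
    · unfold repl
      split_ifs with he
      · exact Or.inl rfl
      · exact Or.inr fun hb => ((hav i).resolve_left he) ⟨hR.trans hxz hb.1, hb.2⟩
    · rw [repl_repl, ← h]
      · exact hΦ
      · exact fun i => (hav i).imp_right fun h e => h ⟨by rwa [e], by rwa [e]⟩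
  · left
    exact ⟨hxz, h₁, s, hs, fun i => (hav i).imp_right fun h hb => h ⟨hb.1, hR.trans hb.2 hzy⟩, h⟩

theorem HasJumps.mono (hR : IsLin R) (hR' : IsLin R') (h : R ≤ R') (hj : HasJumps K R Φ) :
    HasJumps K R' Φ := by
  obtain ⟨P, hP, h₁, h₂⟩ := hj
  exact ⟨P, hP, fun p hp => (h₁ p hp).mono hR hR' h,
    fun p hp q hq hpq => (h₂ p hp q hq hpq).imp (h _ _) (h _ _)⟩

theorem HasJumps.swap (hR : IsLin R) (hj : HasJumps K R Φ) : HasJumps K (Function.swap R) Φ := by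
  obtain ⟨P, hP, h₁, h₂⟩ := hj
  refine ⟨P.map (Equiv.prodComm T T).toEmbedding, by simpa using hP, ?_, ?_⟩
  · rintro ⟨a, b⟩ hp
    have hp' : (b, a) ∈ P := by simpa [Prod.swap] using hp
    exact (h₁ _ hp').swap hR
  · rintro ⟨a, b⟩ hp ⟨a', b'⟩ hq hpq
    have hp' : (b, a) ∈ P := by simpa [Prod.swap] using hp
    have hq' : (b', a') ∈ P := by simpa [Prod.swap] using hq
    exact (h₂ _ hp' _ hq' (by grind)).symm

theorem Consec.swap (h : Consec R x y) : Consec (Function.swap R) y x :=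
  ⟨h.1, h.2.1.symm, fun z h₁ h₂ => (h.2.2 z h₂ h₁).symm⟩

theorem HasGaps.swap (hR : IsLin R) (hj : HasGaps K R Φ) : HasGaps K (Function.swap R) Φ := by
  obtain ⟨P, hP, h₁⟩ := hj
  refine ⟨P.map (Equiv.prodComm T T).toEmbedding, by simpa using hP, ?_⟩
  rintro ⟨a, b⟩ hp
  have hp' : (b, a) ∈ P := by simpa [Prod.swap] using hp
  exact ⟨(h₁ _ hp').1.swap hR, (h₁ _ hp').2.swap⟩

theorem HasGaps.hasJumps (hR : IsLin R) (hj : HasGaps K R Φ) : HasJumps K R Φ := by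
  obtain ⟨P, hP, h₁⟩ := hj
  refine ⟨P, hP, fun p hp => (h₁ p hp).1, fun p hp q hq hpq => ?_⟩
  by_contra! hcon
  obtain ⟨a1, a2, a3⟩ := (h₁ p hp).2
  obtain ⟨b1, b2, b3⟩ := (h₁ q hq).2
  have c1 := (hR.total (hR.right a1) (hR.left b1)).resolve_left hcon.1
  have c2 := (hR.total (hR.right b1) (hR.left a1)).resolve_left hcon.2
  have e1 : p.1 = q.1 := by
    rcases hR.total (hR.left a1) (hR.left b1) with h | h
    · rcases a3 _ h c1 with e | e
      · exact e.symm
      · exact absurd (by rw [e]; exact hR.right a1) hcon.1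
    · rcases b3 _ h c2 with e | e
      · exact e
      · exact absurd (by rw [e]; exact hR.right b1) hcon.2
  have e2 : p.2 = q.2 := by
    rcases hR.total (hR.right a1) (hR.right b1) with h | h
    · rcases b3 _ (e1 ▸ a1) h with e | e
      · exact absurd (e.trans e1.symm) a2.symm
      · exact e
    · rcases a3 _ (e1 ▸ b1) h with e | e
      · exact absurd (e.trans e1) b2.symm
      · exact e.symm
  exact hpq (Prod.ext e1 e2)

end Jumps

/-! ### Independent jumps -/

/-- A finite digraph in which every vertex has at most `n` successors and which has at least
`(2 n + 1) h` vertices has an independent set of size `h`. -/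
theorem exists_independent {α : Type*} (D : α → α → Prop) (n h : ℕ) : ∀ V : Finset α,
    (∀ p ∈ V, ∀ W ⊆ V, (∀ q ∈ W, D p q) → W.card ≤ n) → (2 * n + 1) * h ≤ V.card →
    ∃ H ⊆ V, H.card = h ∧ ∀ p ∈ H, ∀ q ∈ H, p ≠ q → ¬ D p q := by
  classical
  induction h with
  | zero => exact fun V _ _ => ⟨∅, by simp, by simp, by simp⟩
  | succ h ih =>
    intro V hV hc
    have hne : V.Nonempty := by
      rw [← Finset.card_pos]
      nlinarith
    have hin : ∃ q ∈ V, (V.filter fun p => D p q).card ≤ n := by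
      by_contra! hcon
      have h1 : ∑ q ∈ V, (V.filter fun p => D p q).card =
          ∑ p ∈ V, (V.filter fun q => D p q).card := by
        simp only [Finset.card_filter]
        exact Finset.sum_comm
      have h2 : ∑ p ∈ V, (V.filter fun q => D p q).card ≤ ∑ p ∈ V, n :=
        Finset.sum_le_sum fun p hp => hV p hp _ (Finset.filter_subset _ _) (by simp)
      have h3 : ∑ p ∈ V, n < ∑ q ∈ V, (V.filter fun p => D p q).card :=
        Finset.sum_lt_sum_of_nonempty hne hcon
      omega
    obtain ⟨q, hq, hqn⟩ := hin
    have hout : (V.filter fun p => D q p).card ≤ n :=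
      hV q hq _ (Finset.filter_subset _ _) (by simp)
    let B := insert q ((V.filter fun p => D p q) ∪ (V.filter fun p => D q p))
    have hB : B.card ≤ 2 * n + 1 := by
      refine (Finset.card_insert_le _ _).trans ?_
      have := Finset.card_union_le (V.filter fun p => D p q) (V.filter fun p => D q p)
      omega
    obtain ⟨H, hH, hHc, hHD⟩ := ih (V \ B)
      (fun p hp W hW => hV p (Finset.sdiff_subset hp) W (hW.trans Finset.sdiff_subset))
      (by
        have := Finset.le_card_sdiff B V
        have h5 : (2 * n + 1) * (h + 1) = (2 * n + 1) * h + (2 * n + 1) := by ring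
        omega)
    have hq' : q ∉ H := fun hqH => by
      have := hH hqH
      simp [B] at this
    have key : ∀ p ∈ H, ¬ D p q ∧ ¬ D q p := fun p hp => by
      have := hH hp
      simp only [B, Finset.mem_sdiff, Finset.mem_insert, Finset.mem_union,
        Finset.mem_filter] at this
      tauto
    refine ⟨insert q H, Finset.insert_subset hq (hH.trans Finset.sdiff_subset), ?_, ?_⟩
    · rw [Finset.card_insert_of_notMem hq', hHc]
    · intro p hp p' hp' hpp'
      rcases Finset.mem_insert.1 hp with e | hp
      · rcases Finset.mem_insert.1 hp' with e' | hp'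
        · exact absurd (e.trans e'.symm) hpp'
        · rw [e]
          exact (key p' hp').2
      · rcases Finset.mem_insert.1 hp' with e' | hp'
        · rw [e']
          exact (key p hp).1
        · exact hHD p hp p' hp' hpp'

/-- From many non-overlapping jumps one gets `h` pairs of tuples `s true j`, `s false j`, on which
`Φ` takes different truth values, such that in each pair the one may be replaced by the other,
independently of the other pairs, without a change of the order type. -/
theorem HasJumps.exists_independent {R : T → T → Prop} (hR : IsLin R) {n : ℕ}
    {Φ : (Fin n → T) → Prop} {K h : ℕ} (hj : HasJumps K R Φ) (hK : (2 * (4 * n) + 1) * h ≤ K) :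
    ∃ s : Bool → Fin h → Fin n → T, (∀ e j i, R (s e j i) (s e j i)) ∧
      (∀ j, ¬ (Φ (s true j) ↔ Φ (s false j))) ∧
      ∀ (e : Fin h → Bool) (j j' : Fin h) (i i' : Fin n),
        R (s (e j) j i) (s (e j') j' i') ↔ R (s true j i) (s true j' i') := by
  classical
  obtain ⟨P, rfl, hJ, hP⟩ := hj
  have hs : ∀ p : T × T, ∃ s : Fin n → T, p ∈ P → (∀ i, R (s i) (s i)) ∧
      (∀ i, s i = p.1 ∨ ¬ (R p.1 (s i) ∧ R (s i) p.2)) ∧ ¬ (Φ s ↔ Φ (repl p.1 p.2 s)) := by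
    intro p
    by_cases hp : p ∈ P
    · exact (hJ p hp).2.2.imp fun s hs _ => hs
    · exact ⟨fun _ => p.1, fun h => absurd h hp⟩
  choose s hs using hs
  let t : T × T → Fin n → T := fun p => repl p.1 p.2 (s p)
  have ht : ∀ p ∈ P, ∀ i, R (t p i) (t p i) := fun p hp i =>
    repl_mem (hR.right (hJ p hp).1) (hs p hp).1 i
  let D : T × T → T × T → Prop := fun p q =>
    ∃ i, (R q.1 (s p i) ∧ R (s p i) q.2) ∨ (R q.1 (t p i) ∧ R (t p i) q.2)
  -- a point lies in at most two of the intervals, which may have an end in common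
  have hpt : ∀ z, ((P.filter fun q => R q.1 z ∧ R z q.2)).card ≤ 2 := by
    intro z
    have h1 : (P.filter fun q => R q.1 z ∧ R z q.2 ∧ z ≠ q.2).card ≤ 1 := by
      refine Finset.card_le_one.2 fun p hp q hq => ?_
      simp only [Finset.mem_filter] at hp hq
      by_contra hpq
      rcases hP p hp.1 q hq.1 hpq with h | h
      · exact hp.2.2.2 (hR.antisymm hp.2.2.1 (hR.trans h hq.2.1))
      · exact hq.2.2.2 (hR.antisymm hq.2.2.1 (hR.trans h hp.2.1))
    have h2 : (P.filter fun q => z = q.2).card ≤ 1 := by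
      refine Finset.card_le_one.2 fun p hp q hq => ?_
      simp only [Finset.mem_filter] at hp hq
      have e : p.2 = q.2 := hp.2.symm.trans hq.2
      by_contra hpq
      rcases hP p hp.1 q hq.1 hpq with h | h
      · exact (hJ q hq.1).2.1 (hR.antisymm (hJ q hq.1).1 (e ▸ h))
      · exact (hJ p hp.1).2.1 (hR.antisymm (hJ p hp.1).1 (e ▸ h))
    have h3 : (P.filter fun q => R q.1 z ∧ R z q.2) ⊆
        (P.filter fun q => R q.1 z ∧ R z q.2 ∧ z ≠ q.2) ∪ (P.filter fun q => z = q.2) := by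
      intro q
      simp only [Finset.mem_filter, Finset.mem_union]
      tauto
    have := (Finset.card_le_card h3).trans (Finset.card_union_le _ _)
    omega
  obtain ⟨H, hHP, hH, hHD⟩ := _root_.exists_independent D (4 * n) h P (by
    intro p _ W hW hWD
    have h1 : W ⊆ Finset.univ.biUnion fun i : Fin n =>
        (P.filter fun q => R q.1 (s p i) ∧ R (s p i) q.2) ∪
          (P.filter fun q => R q.1 (t p i) ∧ R (t p i) q.2) := by
      intro q hq
      obtain ⟨i, hi⟩ := hWD q hq
      have := hW hq
      simp only [Finset.mem_biUnion, Finset.mem_union, Finset.mem_filter, Finset.mem_univ,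
        true_and]
      exact ⟨i, by tauto⟩
    refine (Finset.card_le_card h1).trans ?_
    refine (Finset.card_biUnion_le_card_mul _ _ 4 fun i _ => ?_).trans ?_
    · have := Finset.card_union_le (P.filter fun q => R q.1 (s p i) ∧ R (s p i) q.2)
        (P.filter fun q => R q.1 (t p i) ∧ R (t p i) q.2)
      have a1 := hpt (s p i)
      have a2 := hpt (t p i)
      omega
    · simp [mul_comm]) hK
  let f := (H.equivFinOfCardEq hH).symm
  have hf : ∀ j, (f j : T × T) ∈ P := fun j => hHP (f j).2
  let w : Bool → Fin h → Fin n → T := fun e j => if e then s (f j) else t (f j)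
  -- `x` and `y` have the same position with respect to a point outside of `[x, y]`
  have hmove : ∀ p ∈ P, ∀ z, R z z → ¬ (R p.1 z ∧ R z p.2) →
      (R p.2 z ↔ R p.1 z) ∧ (R z p.2 ↔ R z p.1) := by
    intro p hp z hz hn
    have h0 := (hJ p hp).1
    refine ⟨⟨fun h => hR.trans h0 h, fun h => ?_⟩, ⟨fun h => ?_, fun h => hR.trans h h0⟩⟩
    · exact (hR.total (hR.right h0) hz).resolve_right fun h' => hn ⟨h, h'⟩
    · exact (hR.total hz (hR.left h0)).resolve_right fun h' => hn ⟨h', h⟩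
  have hw : ∀ e j i, R (w e j i) (w e j i) := by
    intro e j i
    cases e
    · exact ht _ (hf j) i
    · exact (hs _ (hf j)).1 i
  have hst : ∀ e j z i, R z z → ¬ (R (f j).1.1 z ∧ R z (f j).1.2) →
      (R (w e j i) z ↔ R (w true j i) z) ∧ (R z (w e j i) ↔ R z (w true j i)) := by
    intro e j z i hz hn
    cases e
    · have := hmove _ (hf j) z hz hn
      simp only [w, t]
      by_cases hx : s (f j) i = (f j).1.1
      · simpa [repl, hx] using this
      · simp [repl, hx]
    · simp
  have hout : ∀ j j', j ≠ j' → ∀ e i, ¬ (R (f j).1.1 (w e j' i) ∧ R (w e j' i) (f j).1.2) := by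
    intro j j' hjj e i hb
    refine hHD _ (f j').2 _ (f j).2 ?_ ⟨i, ?_⟩
    · exact fun h => hjj (f.injective (Subtype.ext h)).symm
    · cases e
      · exact Or.inr hb
      · exact Or.inl hb
  refine ⟨w, hw, fun j => (hs _ (hf j)).2.2, fun e j j' i i' => ?_⟩
  by_cases hjj : j = j'
  · subst hjj
    cases e j
    · have hav := fun k => ((hs _ (hf j)).2.1 k)
      have hm := fun k => hmove _ (hf j) (s (f j) k) ((hs _ (hf j)).1 k)
      have r1 := hR.left (hJ _ (hf j)).1
      have r2 := hR.right (hJ _ (hf j)).1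
      simp only [w, t]
      by_cases hx : s (f j) i = (f j).1.1
      · by_cases hx' : s (f j) i' = (f j).1.1
        · simp [repl, hx, hx', r1, r2]
        · have := (hm i' ((hav i').resolve_left hx')).1
          simpa [repl, hx, hx'] using this
      · by_cases hx' : s (f j) i' = (f j).1.1
        · have := (hm i ((hav i).resolve_left hx)).2
          simpa [repl, hx, hx'] using this
        · simp [repl, hx, hx']
    · rfl
  · rw [(hst (e j) j _ i (hw _ _ _) (hout j j' hjj _ _)).1,
      (hst (e j') j' _ i' (hw _ _ _) (hout j' j (Ne.symm hjj) _ _)).2]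

end Orders

/-! ### Maximisation of predicates along chains -/

section Stable

/-- Suppose that in a preorder every chain which is indexed by `D` has an upper bound. Then for any
family, indexed by `D`, of upward closed predicates every element lies below one above which none
of the predicates becomes newly true. -/
theorem exists_stable {E : Type*} {D : Type*} [Nonempty D] (le : E → E → Prop)
    (hrefl : ∀ e, le e e) (htrans : ∀ {a b c}, le a b → le b c → le a c)
    (hub : ∀ g : D → E, (∀ d d', le (g d) (g d') ∨ le (g d') (g d)) → ∃ e, ∀ d, le (g d) e)
    (Q : D → E → Prop) (hQ : ∀ d a b, le a b → Q d a → Q d b) (e₀ : E) :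
    ∃ e, le e₀ e ∧ ∀ e', le e e' → ∀ d, Q d e' → Q d e := by
  classical
  -- `lt a b` means that `a ≤ b` and that some predicate is true at `b`, but not at `a`
  let lt : E → E → Prop := fun a b => le a b ∧ ∃ d, Q d b ∧ ¬ Q d a
  have lt_trans : ∀ {a b c}, lt a b → lt b c → lt a c := by
    rintro a b c ⟨h₁, d, h₂, h₃⟩ ⟨h₄, -⟩
    exact ⟨htrans h₁ h₄, d, hQ d _ _ h₄ h₂, h₃⟩
  let E' := {e // le e₀ e}
  let r : E' → E' → Prop := fun a b => a = b ∨ lt a b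
  have hle : ∀ a b : E', r a b → le a b := by
    rintro a b (rfl | h)
    · exact hrefl _
    · exact h.1
  obtain ⟨m, hm⟩ := exists_maximal_of_chains_bounded (r := r) (by
    intro c hc
    rcases c.eq_empty_or_nonempty with rfl | ⟨a₀, ha₀⟩
    · exact ⟨⟨e₀, hrefl _⟩, by simp⟩
    by_cases htop : ∃ a ∈ c, ∀ d, (∃ b ∈ c, Q d b.1) → Q d a.1
    · obtain ⟨a, ha, hd⟩ := htop
      refine ⟨a, fun b hb => ?_⟩
      by_cases hab : b = a
      · exact Or.inl hab
      · rcases hc hb ha hab with h | h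
        · exact h
        · rcases h with h | ⟨-, d, h₁, h₂⟩
          · exact Or.inl h.symm
          · exact absurd (hd d ⟨b, hb, h₁⟩) h₂
    · push Not at htop
      let g : D → E' := fun d => if h : ∃ b ∈ c, Q d b.1 then h.choose else a₀
      have hg : ∀ d, g d ∈ c := by
        intro d
        by_cases h : ∃ b ∈ c, Q d b.1
        · simp only [g, dif_pos h]
          exact h.choose_spec.1
        · simp only [g, dif_neg h]
          exact ha₀
      have hgQ : ∀ d, (∃ b ∈ c, Q d b.1) → Q d (g d).1 := by
        intro d h
        simp only [g, dif_pos h]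
        exact h.choose_spec.2
      obtain ⟨e, he⟩ := hub (fun d => (g d).1) (by
        intro d d'
        by_cases h : g d = g d'
        · rw [h]
          exact Or.inl (hrefl _)
        · exact (hc (hg d) (hg d') h).imp (hle _ _) (hle _ _))
      obtain ⟨d₀⟩ := (inferInstance : Nonempty D)
      refine ⟨⟨e, htrans (g d₀).2 (he d₀)⟩, fun a ha => Or.inr ?_⟩
      obtain ⟨d, hd, hda⟩ := htop a ha
      have h1 : lt a.1 (g d).1 := by
        have hne : a ≠ g d := fun h => hda (by rw [h]; exact hgQ d hd)
        rcases hc ha (hg d) hne with h | h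
        · exact h.resolve_left hne
        · exact absurd (hQ d _ _ (hle _ _ h) (hgQ d hd)) hda
      exact ⟨htrans h1.1 (he d), d, hQ d _ _ (he d) (hgQ d hd), hda⟩) (by
    rintro a b c (rfl | h) (rfl | h')
    · exact Or.inl rfl
    · exact Or.inr h'
    · exact Or.inr h
    · exact Or.inr (lt_trans h h'))
  refine ⟨m.1, m.2, fun e' he' d hd => ?_⟩
  by_contra hcon
  have h1 : lt m.1 e' := ⟨he', d, hd, hcon⟩
  rcases hm ⟨e', htrans m.2 he'⟩ (Or.inr h1) with h | ⟨h, -⟩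
  · exact hcon (by rw [← h]; exact hd)
  · exact hcon (hQ d _ _ h hd)

end Stable

/-! ### Limits along ultrafilters and jumps -/

section Limits

open Filter

variable {T : Type u} {Δ : Type u} {ar : Δ → ℕ} {Φ : ∀ δ, (Fin (ar δ) → T) → Prop}

/-- `R'` arises from `R` by the addition of an element `b` which is a limit along the ultrafilter
`U`, both with respect to the order and with respect to the relations `Φ δ`. -/
structure LimExt (Φ : ∀ δ, (Fin (ar δ) → T) → Prop) (R : T → T → Prop) (U : Ultrafilter T) (b : T)
    (R' : T → T → Prop) : Prop where
  le : R ≤ R'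
  dom : ∀ x, R' x x ↔ R x x ∨ x = b
  left : ∀ x, R x x → (R' x b ↔ ∀ᶠ z in U, R x z)
  right : ∀ x, R x x → (R' b x ↔ ∀ᶠ z in U, R z x)
  lim : ∀ δ s, (∀ i, R' (s i) (s i)) → (Φ δ s ↔ ∀ᶠ z in U, Φ δ (repl b z s))

variable {R R' : T → T → Prop} {U : Ultrafilter T} {b : T} {K : ℕ} {δ : Δ}

theorem LimExt.swap (h : LimExt Φ R U b R') :
    LimExt Φ (Function.swap R) U b (Function.swap R') where
  le := fun _ _ => h.le _ _
  dom := h.dom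
  left := h.right
  right := h.left
  lim := h.lim

/-- A limit creates no new jumps between old elements. -/
theorem LimExt.jump_of_jump (h : LimExt Φ R U b R') (hR : IsLin R) (hR' : IsLin R')
    (hU : ∀ᶠ z in U, R z z) (hb : ¬ R b b) {x y : T} (hx : R x x) (hy : R y y)
    (hj : Jump R' (Φ δ) x y) : Jump R (Φ δ) x y := by
  obtain ⟨hxy, hne, s, hs, hav, hΦ⟩ := hj
  have hxy' : R x y := hR.of_le hR' h.le hx hy hxy
  have hxb : b ≠ x := fun e => hb (e ▸ hx)
  have hyb : b ≠ y := fun e => hb (e ▸ hy)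
  -- a tuple close to `s` witnesses the jump
  have hz : ∀ᶠ z in U, (∀ i, R (repl b z s i) (repl b z s i)) ∧
      (∀ i, repl b z s i = x ∨ ¬ (R x (repl b z s i) ∧ R (repl b z s i) y)) ∧
      repl b z (repl x y s) = repl x y (repl b z s) := by
    have h1 : ∀ᶠ z in U, (∃ i, s i = b) → ¬ (R x z ∧ R z y) := by
      by_cases hi : ∃ i, s i = b
      · obtain ⟨i, hi⟩ := hi
        have h2 : ¬ (R' x b ∧ R' b y) := by
          rw [← hi]
          exact (hav i).resolve_left fun e => hxb (hi.symm.trans e)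
        rw [h.left x hx, h.right y hy, ← eventually_and, ← Ultrafilter.eventually_not] at h2
        exact h2.mono fun z hz _ => hz
      · exact Eventually.of_forall fun z hz => absurd hz hi
    filter_upwards [h1, hU] with z hz hzz
    refine ⟨fun i => ?_, fun i => ?_, ?_⟩
    · by_cases hi : s i = b
      · simpa [repl, hi] using hzz
      · simpa [repl, hi] using ((h.dom _).1 (hs i)).resolve_right hi
    · by_cases hi : s i = b
      · simpa [repl, hi] using Or.inr (not_and.1 (hz ⟨i, hi⟩))
      · have : s i = x ∨ ¬ (R x (s i) ∧ R (s i) y) :=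
          (hav i).imp_right fun hn hc => hn ⟨h.le _ _ hc.1, h.le _ _ hc.2⟩
        simpa [repl, hi] using this
    · funext i
      by_cases hi : s i = b
      · have hzx : z ≠ x := fun e => hz ⟨i, hi⟩ (by rw [e]; exact ⟨hx, hxy'⟩)
        simp [repl, hi, hzx, hxb]
      · by_cases hi' : s i = x
        · simp [repl, hi', hxb.symm, hyb.symm]
        · simp [repl, hi, hi']
  by_contra hcon
  refine hΦ ?_
  rw [h.lim δ s hs, h.lim δ _ (fun i => repl_mem (hR'.right hxy) hs i)]
  refine eventually_congr ?_
  filter_upwards [hz] with z hz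
  by_contra hc
  rw [hz.2.2] at hc
  exact hcon ⟨hxy', hne, repl b z s, hz.1, hz.2.1, hc⟩

/-- If there are boundedly many non-overlapping jumps, then there is no jump between a limit and the
elements which are close to it: otherwise jump after jump could be found in `R`. -/
theorem LimExt.not_jump (h : LimExt Φ R U b R') (hR : IsLin R) (hR' : IsLin R')
    (hU : ∀ᶠ z in U, R z z) (hK : ¬ HasJumps K R (Φ δ)) :
    ∀ᶠ z in U, ¬ Jump R' (Φ δ) z b := by
  classical
  by_contra hcon
  rw [Ultrafilter.eventually_not, not_not] at hcon
  have hJ := hcon.and hU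
  have step : ∀ z, Jump R' (Φ δ) z b → R z z → ∀ᶠ z' in U, Jump R (Φ δ) z z' := by
    rintro z ⟨hzb, hne, s, hs, hav, hΦ⟩ hz
    have hsb : ∀ i, s i ≠ b := by
      intro i e
      rcases hav i with h1 | h1
      · exact hne (h1.symm.trans e)
      · exact h1 ⟨by rwa [e], by rw [e]; exact hR'.right hzb⟩
    have hsR : ∀ i, R (s i) (s i) := fun i => ((h.dom _).1 (hs i)).resolve_right (hsb i)
    have h1 : ∀ᶠ z' in U, R z z' := (h.left z hz).1 hzb
    have h2 : ∀ᶠ z' in U, z ≠ z' := by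
      rw [Ultrafilter.eventually_not]
      intro h2
      refine hne (hR'.antisymm hzb ((h.right z hz).2 ?_))
      filter_upwards [h2] with z' e
      rwa [← e]
    have h3 : ∀ᶠ z' in U, ∀ i, s i = z ∨ ¬ (R z (s i) ∧ R (s i) z') := by
      rw [eventually_all]
      intro i
      rcases hav i with h4 | h4
      · exact Eventually.of_forall fun _ => Or.inl h4
      · by_cases h5 : R z (s i)
        · have h6 : ¬ R' (s i) b := fun h6 => h4 ⟨h.le _ _ h5, h6⟩
          rw [h.left _ (hsR i), ← Ultrafilter.eventually_not] at h6
          exact h6.mono fun z' h7 => Or.inr fun h8 => h7 h8.2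
        · exact Eventually.of_forall fun _ => Or.inr fun h8 => h5 h8.1
    have h4 : ∀ᶠ z' in U, ¬ (Φ δ s ↔ Φ δ (repl z z' s)) := by
      rw [h.lim δ (repl z b s) (fun i => repl_mem (hR'.right hzb) hs i)] at hΦ
      have h5 : ∀ z', repl b z' (repl z b s) = repl z z' s := fun z' =>
        repl_repl fun i => Or.inr (hsb i)
      simp only [h5] at hΦ
      by_cases h6 : Φ δ s
      · simp only [h6, true_iff] at hΦ ⊢
        rwa [Ultrafilter.eventually_not]
      · simp only [h6, false_iff, not_not] at hΦ ⊢
        exact hΦ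
    filter_upwards [h1, h2, h3, h4] with z' h1 h2 h3 h4
    exact ⟨h1, h2, s, hsR, h3, h4⟩
  have chain : ∀ k : ℕ, ∃ (P : Finset (T × T)) (z : T), P.card = k ∧
      (∀ p ∈ P, Jump R (Φ δ) p.1 p.2) ∧ (∀ p ∈ P, ∀ q ∈ P, p ≠ q → R p.2 q.1 ∨ R q.2 p.1) ∧
      (∀ p ∈ P, R p.2 z) ∧ Jump R' (Φ δ) z b ∧ R z z := by
    intro k
    induction k with
    | zero =>
      obtain ⟨z, hz⟩ := hJ.exists
      exact ⟨∅, z, by simp, by simp, by simp, by simp, hz⟩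
    | succ k ih =>
      obtain ⟨P, z, hP, h1, h2, h3, h4, h5⟩ := ih
      obtain ⟨z', h6, h7, h8⟩ := ((step z h4 h5).and hJ).exists
      have hn : (z, z') ∉ P := fun hc => h6.2.1 (hR.antisymm h6.1 (h3 _ hc))
      refine ⟨insert (z, z') P, z', by rw [Finset.card_insert_of_notMem hn, hP], ?_, ?_, ?_, h7, h8⟩
      · intro p hp
        rcases Finset.mem_insert.1 hp with rfl | hp
        · exact h6
        · exact h1 p hp
      · intro p hp q hq hpq
        rcases Finset.mem_insert.1 hp with rfl | hp
        · rcases Finset.mem_insert.1 hq with rfl | hq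
          · exact absurd rfl hpq
          · exact Or.inr (h3 q hq)
        · rcases Finset.mem_insert.1 hq with rfl | hq
          · exact Or.inl (h3 p hp)
          · exact h2 p hp q hq hpq
      · intro p hp
        rcases Finset.mem_insert.1 hp with rfl | hp
        · exact h8
        · exact hR.trans (h3 p hp) h6.1
  obtain ⟨P, z, hP, h1, h2, -⟩ := chain K
  exact hK ⟨P, hP, h1, h2⟩

/-- A proper limit is not inserted between an element and its successor. -/
theorem LimExt.consec (h : LimExt Φ R U b R') (hR : IsLin R) (hR' : IsLin R') (hb : ¬ R b b)
    {x y : T} (hc : Consec R x y) : Consec R' x y := by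
  obtain ⟨hxy, hne, hz⟩ := hc
  have hx := hR.left hxy
  have hy := hR.right hxy
  refine ⟨h.le _ _ hxy, hne, fun z h1 h2 => ?_⟩
  rcases (h.dom z).1 (hR'.right h1) with hzz | rfl
  · exact hz z (hR.of_le hR' h.le hx hzz h1) (hR.of_le hR' h.le hzz hy h2)
  · exfalso
    have h3 : ∀ᶠ w in U, w = x ∨ w = y := by
      filter_upwards [(h.left x hx).1 h1, (h.right y hy).1 h2] with w hw1 hw2
      exact hz w hw1 hw2
    rcases Ultrafilter.eventually_or.1 h3 with h4 | h4
    · have h5 : R' z x := (h.right x hx).2 (h4.mono fun w e => e ▸ hx)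
      exact hb (hR'.antisymm h1 h5 ▸ hx)
    · have h5 : R' y z := (h.left y hy).2 (h4.mono fun w e => e ▸ hy)
      exact hb (hR'.antisymm h5 h2 ▸ hy)

/-- `R'` extends `R` without putting elements into the gaps of `R` at which some `Φ δ` jumps. -/
def GapLe (Φ : ∀ δ, (Fin (ar δ) → T) → Prop) (R R' : T → T → Prop) : Prop :=
  R ≤ R' ∧ ∀ δ x y, Jump R (Φ δ) x y → Consec R x y → Consec R' x y

theorem GapLe.refl (R : T → T → Prop) : GapLe Φ R R := ⟨le_rfl, fun _ _ _ _ h => h⟩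

theorem GapLe.trans {R'' : T → T → Prop} (hR : IsLin R) (hR' : IsLin R') (h : GapLe Φ R R')
    (h' : GapLe Φ R' R'') : GapLe Φ R R'' :=
  ⟨h.1.trans h'.1, fun δ x y hj hc => h'.2 δ x y (hj.mono hR hR' h.1) (h.2 δ x y hj hc)⟩

theorem GapLe.swap (hR' : IsLin (Function.swap R)) (h : GapLe Φ R R') :
    GapLe Φ (Function.swap R) (Function.swap R') :=
  ⟨fun _ _ => h.1 _ _, fun δ _ _ hj hc => (h.2 δ _ _ (hj.swap hR') hc.swap).swap⟩

theorem HasGaps.mono (hR : IsLin R) (hR' : IsLin R') (h : GapLe Φ R R')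
    (hg : HasGaps K R (Φ δ)) : HasGaps K R' (Φ δ) := by
  obtain ⟨P, hP, h1⟩ := hg
  exact ⟨P, hP, fun p hp => ⟨(h1 p hp).1.mono hR hR' h.1, h.2 δ _ _ (h1 p hp).1 (h1 p hp).2⟩⟩

theorem LimExt.gapLe (h : LimExt Φ R U b R') (hR : IsLin R) (hR' : IsLin R') (hb : ¬ R b b) :
    GapLe Φ R R' :=
  ⟨h.le, fun _ _ _ _ hc => h.consec hR hR' hb hc⟩

/-- Two tuples of the same order type satisfy the same `Φ`, if there is no jump between
corresponding members: the one can be moved to the other, one member at a time. -/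
theorem iff_of_not_jump {n : ℕ} {Φ : (Fin n → T) → Prop} (hR : IsLin R) (s : Fin n → T)
    (hs : ∀ i, R (s i) (s i)) : ∀ v : Fin n → T, (∀ i, R (v i) (v i)) →
    (∀ i j, R (s i) (s j) ↔ R (v i) (v j)) →
    (∀ i, ¬ Jump R Φ (s i) (v i) ∧ ¬ Jump R Φ (v i) (s i)) → (Φ s ↔ Φ v) := by
  classical
  suffices H : ∀ (k : ℕ) (v : Fin n → T), (Finset.univ.filter fun i => s i ≠ v i).card = k →
      (∀ i, R (v i) (v i)) → (∀ i j, R (s i) (s j) ↔ R (v i) (v j)) →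
      (∀ i, ¬ Jump R Φ (s i) (v i) ∧ ¬ Jump R Φ (v i) (s i)) → (Φ s ↔ Φ v) from
    fun v => H _ v rfl
  intro k
  induction k using Nat.strong_induction_on with
  | _ k ih =>
  intro v hk hv hsv hj
  -- `i` is the member to be moved
  have main : ∀ i, s i ≠ v i →
      (∀ l, v l = v i ∨ ¬ ((R (v i) (v l) ∧ R (v l) (s i)) ∨ (R (s i) (v l) ∧ R (v l) (v i)))) →
      (Φ v ↔ Φ (repl (v i) (s i) v)) → (Φ s ↔ Φ v) := by
    intro i hi hav hΦ
    have heq : ∀ l, v l = v i → s l = s i := fun l hl =>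
      hR.antisymm ((hsv l i).2 (hl ▸ hv i)) ((hsv i l).2 (hl ▸ hv i))
    have hmem : ∀ l, R (repl (v i) (s i) v l) (repl (v i) (s i) v l) := repl_mem (hs i) hv
    have hcases : ∀ l, repl (v i) (s i) v l = s l ∨ repl (v i) (s i) v l = v l := by
      intro l
      by_cases hl : v l = v i
      · left
        simp [repl, hl, heq l hl]
      · right
        simp [repl, hl]
    rw [hΦ]
    refine ih _ ?_ _ rfl hmem (fun a c => ?_) fun l => ?_
    · rw [← hk]
      refine Finset.card_lt_card ((Finset.ssubset_iff_of_subset ?_).2 ⟨i, ?_, ?_⟩)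
      · intro l
        simp only [Finset.mem_filter, Finset.mem_univ, true_and]
        intro h e
        rcases hcases l with h1 | h1
        · exact h h1.symm
        · exact h (h1 ▸ e)
      · simpa using hi
      · intro h
        rw [Finset.mem_filter] at h
        exact h.2 (by simp [repl])
    · rw [hsv]
      -- a point outside of the hull of `v i` and `s i` has the same position to both of them
      have hpos : ∀ l, v l ≠ v i →
          (R (v i) (v l) ↔ R (s i) (v l)) ∧ (R (v l) (v i) ↔ R (v l) (s i)) := by
        intro l hl
        have h1 := (hav l).resolve_left hl
        push Not at h1
        have t1 := hR.total (hv i) (hv l)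
        have t2 := hR.total (hs i) (hv l)
        have a1 := fun h h' => hl (hR.antisymm (a := v l) (b := v i) h h')
        have a2 : R (v i) (v l) → R (v l) (s i) → False := h1.1
        have a3 : R (s i) (v l) → R (v l) (v i) → False := h1.2
        refine ⟨⟨fun h => ?_, fun h => ?_⟩, ⟨fun h => ?_, fun h => ?_⟩⟩
        · exact t2.resolve_right (a2 h)
        · exact t1.resolve_right (a3 h)
        · exact t2.resolve_left fun h' => a3 h' h
        · exact t1.resolve_left fun h' => a2 h' h
      by_cases ha : v a = v i
      · by_cases hc : v c = v i
        · simp [repl, ha, hc, hv, hs]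
        · simpa [repl, ha, hc] using (hpos c hc).1
      · by_cases hc : v c = v i
        · simpa [repl, ha, hc] using (hpos a ha).2
        · simp [repl, ha, hc]
    · rcases hcases l with h1 | h1
      · rw [h1]
        exact ⟨fun h => h.2.1 rfl, fun h => h.2.1 rfl⟩
      · rw [h1]
        exact hj l
  have hmin : ∀ (r : T → T → Prop), IsLin r → (∀ i, r (v i) (v i)) → ∀ A : Finset (Fin n),
      A.Nonempty → ∃ i ∈ A, ∀ l ∈ A, r (v i) (v l) := by
    intro r hr hv A hA
    induction hA using Finset.Nonempty.cons_induction with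
    | singleton a => exact ⟨a, by simp, by simpa using hv a⟩
    | cons a A ha _ ih =>
      obtain ⟨i, hi, h⟩ := ih
      rcases hr.total (hv a) (hv i) with h1 | h1
      · refine ⟨a, by simp, fun l hl => ?_⟩
        rcases Finset.mem_cons.1 hl with rfl | hl
        · exact hv _
        · exact hr.trans h1 (h l hl)
      · refine ⟨i, by simp [hi], fun l hl => ?_⟩
        rcases Finset.mem_cons.1 hl with rfl | hl
        · exact h1
        · exact h l hl
  by_cases hdown : (Finset.univ.filter fun i => R (s i) (v i) ∧ s i ≠ v i).Nonempty
  · -- move the least of the members which have to move downwards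
    obtain ⟨i, hi, hmini⟩ := hmin R hR hv _ hdown
    simp only [Finset.mem_filter, Finset.mem_univ, true_and] at hi hmini
    have hav : ∀ l, v l = v i ∨ ¬ (R (s i) (v l) ∧ R (v l) (v i)) := by
      intro l
      by_contra! hcon
      obtain ⟨h1, h2, h3⟩ := hcon
      have h4 : R (s l) (s i) := (hsv l i).2 h3
      have h5 : s l ≠ v l := by
        intro e
        refine h1 (hR.antisymm h3 ((hsv i l).1 ?_))
        rwa [e]
      exact h1 (hR.antisymm h3 (hmini l ⟨hR.trans h4 h2, h5⟩))
    refine main i hi.2 (fun l => (hav l).imp_right fun h h' => ?_) ?_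
    · rcases h' with ⟨h1, h2⟩ | h'
      · exact hi.2 (hR.antisymm hi.1 (hR.trans h1 h2))
      · exact h h'
    · by_contra hcon
      refine (hj i).1 (Jump.swap hR.swap ⟨hi.1, hi.2.symm, v, hv, fun l => ?_, hcon⟩)
      exact (hav l).imp_right fun h h' => h ⟨h'.2, h'.1⟩
  · by_cases hup : (Finset.univ.filter fun i => R (v i) (s i) ∧ s i ≠ v i).Nonempty
    · -- move the greatest of the members which have to move upwards
      obtain ⟨i, hi, hmini⟩ := hmin (Function.swap R) hR.swap hv _ hup
      simp only [Finset.mem_filter, Finset.mem_univ, true_and, Function.swap] at hi hmini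
      have hav : ∀ l, v l = v i ∨ ¬ (R (v i) (v l) ∧ R (v l) (s i)) := by
        intro l
        by_contra! hcon
        obtain ⟨h1, h2, h3⟩ := hcon
        have h4 : R (s i) (s l) := (hsv i l).2 h2
        have h5 : s l ≠ v l := by
          intro e
          refine h1 (hR.antisymm ((hsv l i).1 ?_) h2)
          rwa [e]
        exact h1 (hR.antisymm (hmini l ⟨hR.trans h3 h4, h5⟩) h2)
      refine main i hi.2 (fun l => (hav l).imp_right fun h h' => ?_) ?_
      · rcases h' with h' | ⟨h1, h2⟩
        · exact h h'
        · exact hi.2 (hR.antisymm (hR.trans h1 h2) hi.1)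
      · by_contra hcon
        exact (hj i).2 ⟨hi.1, hi.2.symm, v, hv, hav, hcon⟩
    · have : s = v := by
        funext i
        by_contra hi
        rcases hR.total (hs i) (hv i) with h | h
        · exact hdown ⟨i, by simpa using ⟨h, hi⟩⟩
        · exact hup ⟨i, by simpa using ⟨h, hi⟩⟩
      rw [this]

end Limits

/-! ### Stable sequences -/

section Main

open Filter

variable {T : Type u}

theorem exists_last {p : ℕ → Prop} (h0 : p 0) (h : ∃ K, ¬ p K) : ∃ K, p K ∧ ¬ p (K + 1) := by
  by_contra! hcon
  obtain ⟨K, hK⟩ := h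
  exact hK (Nat.rec h0 (fun k hk => hcon k hk) K)

/-- The pairs in `P` are non-overlapping jumps of `Φ`. -/
def JumpFamily (R : T → T → Prop) {n : ℕ} (Φ : (Fin n → T) → Prop) (P : Finset (T × T)) : Prop :=
  (∀ p ∈ P, Jump R Φ p.1 p.2) ∧ ∀ p ∈ P, ∀ q ∈ P, p ≠ q → R p.2 q.1 ∨ R q.2 p.1

section Families

variable {R : T → T → Prop} {n : ℕ} {Φ : (Fin n → T) → Prop} {P : Finset (T × T)}

theorem JumpFamily.insert_jump [DecidableEq (T × T)] (h : JumpFamily R Φ P) {a b : T}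
    (hj : Jump R Φ a b) (hP : ∀ q ∈ P, R b q.1 ∨ R q.2 a) : JumpFamily R Φ (insert (a, b) P) := by
  refine ⟨fun p hp => ?_, fun p hp q hq hpq => ?_⟩
  · rcases Finset.mem_insert.1 hp with rfl | hp
    · exact hj
    · exact h.1 p hp
  · rcases Finset.mem_insert.1 hp with rfl | hp
    · rcases Finset.mem_insert.1 hq with rfl | hq
      · exact absurd rfl hpq
      · exact hP q hq
    · rcases Finset.mem_insert.1 hq with rfl | hq
      · exact (hP p hp).symm
      · exact h.2 p hp q hq hpq

theorem JumpFamily.notMem (hR : IsLin R) {a b : T} (hj : Jump R Φ a b)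
    (hP : ∀ q ∈ P, R b q.1 ∨ R q.2 a) : (a, b) ∉ P := by
  intro hab
  rcases hP _ hab with h | h
  · exact hj.2.1 (hR.antisymm hj.1 h)
  · exact hj.2.1 (hR.antisymm hj.1 h)

/-- Two jumps inside of one member of a family of jumps can take the place of that member. -/
theorem JumpFamily.hasJumps_replace (hR : IsLin R) (h : JumpFamily R Φ P) {p : T × T} (hp : p ∈ P)
    {a b c d : T} (hab : Jump R Φ a b) (hcd : Jump R Φ c d) (hpa : R p.1 a) (hbc : R b c)
    (hdp : R d p.2) : HasJumps (P.card + 1) R Φ := by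
  classical
  have h0 : JumpFamily R Φ (P.erase p) :=
    ⟨fun q hq => h.1 q (Finset.mem_of_mem_erase hq), fun q hq q' hq' =>
      h.2 q (Finset.mem_of_mem_erase hq) q' (Finset.mem_of_mem_erase hq')⟩
  have hsep : ∀ q ∈ P.erase p, R p.2 q.1 ∨ R q.2 p.1 := fun q hq =>
    h.2 p hp q (Finset.mem_of_mem_erase hq) (Finset.ne_of_mem_erase hq).symm
  have h1 : ∀ q ∈ P.erase p, R d q.1 ∨ R q.2 c := fun q hq =>
    (hsep q hq).imp (hR.trans hdp)
      fun h => hR.trans h (hR.trans hpa (hR.trans hab.1 hbc))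
  have h2 : ∀ q ∈ insert (c, d) (P.erase p), R b q.1 ∨ R q.2 a := by
    intro q hq
    rcases Finset.mem_insert.1 hq with rfl | hq
    · exact Or.inl hbc
    · exact (hsep q hq).imp (fun h => hR.trans (hR.trans hbc hcd.1) (hR.trans hdp h))
        fun h => hR.trans h hpa
  refine ⟨_, ?_, (h0.insert_jump hcd h1).insert_jump hab h2⟩
  rw [Finset.card_insert_of_notMem (JumpFamily.notMem hR hab h2),
    Finset.card_insert_of_notMem (JumpFamily.notMem hR hcd h1), Finset.card_erase_add_one hp]

end Families

variable {Δ : Type u} {ar : Δ → ℕ}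

/-- The closure properties of the class of small indiscernible sequences which are used below. -/
structure IsLimClass (Φ : ∀ δ, (Fin (ar δ) → T) → Prop) (Good : (T → T → Prop) → Prop) :
    Prop where
  lin : ∀ {R}, Good R → IsLin R
  swap : ∀ {R}, Good R → Good (Function.swap R)
  bdd : ∀ δ, ∃ K, ∀ R, Good R → ¬ HasJumps K R (Φ δ)
  chain : ∀ g : Δ × ℕ → T → T → Prop, (∀ d, Good (g d)) → (∀ d d', g d ≤ g d' ∨ g d' ≤ g d) →
    Good (⨆ d, g d)
  ext : ∀ R, Good R → ∀ U : Ultrafilter T, (∀ᶠ z in U, R z z) → ∃ b R', Good R' ∧ LimExt Φ R U b R'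

/-- No extension has more jumps. -/
def JumpStable (Φ : ∀ δ, (Fin (ar δ) → T) → Prop) (Good : (T → T → Prop) → Prop)
    (R : T → T → Prop) : Prop :=
  ∀ δ K R', Good R' → R ≤ R' → HasJumps K R' (Φ δ) → HasJumps K R (Φ δ)

/-- No extension which preserves the jumps at gaps has more of them. -/
def GapStable (Φ : ∀ δ, (Fin (ar δ) → T) → Prop) (Good : (T → T → Prop) → Prop)
    (R : T → T → Prop) : Prop :=
  ∀ δ K R', Good R' → GapLe Φ R R' → HasGaps K R' (Φ δ) → HasGaps K R (Φ δ)

variable {Φ : ∀ δ, (Fin (ar δ) → T) → Prop} {Good : (T → T → Prop) → Prop} {R R' : T → T → Prop}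

theorem JumpStable.swap (hC : IsLimClass Φ Good) (hG : Good R) (h : JumpStable Φ Good R) :
    JumpStable Φ Good (Function.swap R) := fun δ K R' hG' hle hj =>
  (h δ K (Function.swap R') (hC.swap hG') (fun _ _ hab => hle _ _ hab)
    (hj.swap (hC.lin hG'))).swap (hC.lin hG)

theorem GapStable.swap (hC : IsLimClass Φ Good) (hG : Good R) (h : GapStable Φ Good R) :
    GapStable Φ Good (Function.swap R) := fun δ K R' hG' hle hj =>
  (h δ K (Function.swap R') (hC.swap hG') (hle.swap (hC.lin hG))
    (hj.swap (hC.lin hG'))).swap (hC.lin hG)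

/-- If `R` is stable, then extensions which preserve its jumps at successors have no further ones:
both ends of such a jump belong to `R`. -/
theorem GapStable.not_gap (hC : IsLimClass Φ Good) (hG : Good R) (h : GapStable Φ Good R)
    (hG' : Good R') (hle : GapLe Φ R R') {δ : Δ} {a b : T} (hj : Jump R' (Φ δ) a b)
    (hc : Consec R' a b) : R a a ∧ R b b := by
  classical
  obtain ⟨B, hB⟩ := hC.bdd δ
  obtain ⟨K, ⟨P, hP, hPg⟩, hK⟩ := exists_last (p := fun K => HasGaps K R (Φ δ)) ⟨∅, by simp⟩
    ⟨B, fun h => hB R hG (h.hasJumps (hC.lin hG))⟩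
  by_contra hcon
  have hn : (a, b) ∉ P := fun hm =>
    hcon ⟨(hC.lin hG).left (hPg _ hm).1.1, (hC.lin hG).right (hPg _ hm).1.1⟩
  refine hK (h δ _ R' hG' hle ⟨insert (a, b) P, ?_, ?_⟩)
  · rw [Finset.card_insert_of_notMem hn, hP]
  · intro p hp
    rcases Finset.mem_insert.1 hp with rfl | hp
    · exact ⟨hj, hc⟩
    · exact ⟨(hPg p hp).1.mono (hC.lin hG) (hC.lin hG') hle.1,
        hle.2 δ _ _ (hPg p hp).1 (hPg p hp).2⟩

/-- Suppose that `R` is stable and `v`, in an extension `R'` of `R`, is a limit from below along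
`U`. Then there is no jump between `v` and the elements of `R` which are close to it. -/
theorem not_jump_of_stable (hC : IsLimClass Φ Good) (hG : Good R) (hS : JumpStable Φ Good R)
    (hS' : GapStable Φ Good R) (hG' : Good R') (hle : R ≤ R') {v : T} {U : Ultrafilter T}
    (hU : ∀ᶠ z in U, R z z) (hl : ∀ x, R x x → (R' x v ↔ ∀ᶠ z in U, R x z))
    (hr : ∀ x, R x x → (R' v x ↔ ∀ᶠ z in U, R z x)) (δ : Δ) :
    ∀ᶠ z in U, ¬ Jump R' (Φ δ) z v := by
  classical
  have hR := hC.lin hG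
  have hR' := hC.lin hG'
  by_contra hcon
  rw [Ultrafilter.eventually_not, not_not] at hcon
  have hlt : ∀ᶠ z in U, R z z ∧ R' z v ∧ z ≠ v :=
    (hU.and hcon).mono fun z hz => ⟨hz.1, hz.2.1, hz.2.2.1⟩
  obtain ⟨z₀, hz₀⟩ := hlt.exists
  have hvv : R' v v := hR'.right hz₀.2.1
  have hv : ¬ R v v := by
    intro hv
    have h1 : ∀ᶠ z in U, R v z := (hl v hv).1 hvv
    obtain ⟨z, hz, hz'⟩ := (hlt.and h1).exists
    exact hz.2.2 (hR'.antisymm hz.2.1 (hle _ _ hz'))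
  -- a family of jumps of maximal size
  obtain ⟨P, hP, hPmax⟩ : ∃ P, JumpFamily R (Φ δ) P ∧ ¬ HasJumps (P.card + 1) R' (Φ δ) := by
    obtain ⟨B, hB⟩ := hC.bdd δ
    obtain ⟨K, ⟨P, rfl, hP⟩, hK⟩ := exists_last (p := fun K => HasJumps K R (Φ δ))
      ⟨∅, by simp⟩ ⟨B, hB R hG⟩
    exact ⟨P, hP, fun h => hK (hS δ _ R' hG' hle h)⟩
  have hPR : ∀ p ∈ P, R p.1 p.1 ∧ R p.2 p.2 := fun p hp =>
    ⟨hR.left (hP.1 p hp).1, hR.right (hP.1 p hp).1⟩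
  have hP' : JumpFamily R' (Φ δ) P := ⟨fun p hp => (hP.1 p hp).mono hR hR' hle,
    fun p hp q hq hpq => (hP.2 p hp q hq hpq).imp (hle _ _) (hle _ _)⟩
  -- one of its members surrounds `v`
  obtain ⟨p, hp, hp1, hp2⟩ : ∃ p ∈ P, R' p.1 v ∧ R' v p.2 := by
    by_contra! hno
    have h1 : ∀ᶠ z in U, ∀ q ∈ P, R' v q.1 ∨ R' q.2 z := by
      rw [eventually_all_finset]
      intro q hq
      rcases hR'.total hvv (hle _ _ (hPR q hq).1) with h | h
      · exact Eventually.of_forall fun _ => Or.inl h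
      · have h2 : R' q.2 v := (hR'.total hvv (hle _ _ (hPR q hq).2)).resolve_left (hno q hq h)
        exact ((hl _ (hPR q hq).2).1 h2).mono fun z hz => Or.inr (hle _ _ hz)
    obtain ⟨z, hz, hz'⟩ := (h1.and hcon).exists
    exact hPmax ⟨_, Finset.card_insert_of_notMem (JumpFamily.notMem hR' hz' hz),
      hP'.insert_jump hz' hz⟩
  obtain ⟨hp1R, hp2R⟩ := hPR p hp
  -- all elements below `v` and close to it jump to all elements above `v` which are at most `p.2`
  have key : ∀ᶠ z in U, ∀ w, R w w → R' v w → R w p.2 → Jump R (Φ δ) z w := by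
    have h1 : ∀ᶠ z in U, R p.1 z := (hl _ hp1R).1 hp1
    filter_upwards [hlt, hcon, h1] with z hz hzj hz1 w hw hvw hwp
    have hzw : R z w := hR.of_le hR' hle hz.1 hw (hR'.trans hz.2.1 hvw)
    have hzw' : z ≠ w := fun e => hz.2.2 (hR'.antisymm hz.2.1 (e ▸ hvw))
    have hzp : z ≠ p.2 := fun e => hz.2.2 (hR'.antisymm hz.2.1 (e ▸ hp2))
    have h2 : Jump R (Φ δ) z p.2 := by
      by_cases he : p.1 = z
      · rw [← he]
        exact hP.1 p hp
      · refine ((hP.1 p hp).split hR hz1 (hR.trans hzw hwp) he hzp).resolve_left fun h => ?_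
        exact hPmax (hP'.hasJumps_replace hR' hp (h.mono hR hR' hle) hzj
          (hle _ _ hp1R) (hle _ _ hz.1) hp2)
    by_cases he : w = p.2
    · rwa [he]
    · refine (h2.split hR hzw hwp hzw' he).resolve_right fun h => ?_
      exact hPmax (hP'.hasJumps_replace hR' hp hzj (h.mono hR hR' hle) (hle _ _ hz1) hvw
        (hle _ _ hp2R))
  -- insert a limit `b` from below
  obtain ⟨b, R₁, hG₁, h₁⟩ := hC.ext R hG U hU
  have hR₁ := hC.lin hG₁
  have hbl : ∀ x, R x x → (R₁ x b ↔ R' x v) := fun x hx => (h₁.left x hx).trans (hl x hx).symm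
  have hbr : ∀ x, R x x → (R₁ b x ↔ R' v x) := fun x hx => (h₁.right x hx).trans (hr x hx).symm
  have hbb : R₁ b b := (h₁.dom b).2 (Or.inr rfl)
  have hb : ¬ R b b := fun hb =>
    hv (hR'.antisymm ((hbl b hb).1 hbb) ((hbr b hb).1 hbb) ▸ hb)
  have hzb : ∀ᶠ z in U, R₁ z b ∧ z ≠ b :=
    hlt.mono fun z hz => ⟨(hbl z hz.1).2 hz.2.1, fun e => hb (e ▸ hz.1)⟩
  obtain ⟨B, hB⟩ := hC.bdd δ
  have hnj₁ := h₁.not_jump (δ := δ) hR hR₁ hU (hB R hG)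
  have hgap₁ := h₁.gapLe hR hR₁ hb
  let C : T → Prop := fun w => R w w ∧ R' v w ∧ R w p.2
  have hbC : ∀ w, C w → R₁ b w ∧ b ≠ w := fun w hw =>
    ⟨(hbr w hw.1).2 hw.2.1, fun e => hb (e ▸ hw.1)⟩
  by_cases hmin : ∃ c, C c ∧ ∀ w, C w → R c w
  · -- the least element above `b` is a successor of `b`
    obtain ⟨c, hc, hcmin⟩ := hmin
    have hj : Jump R₁ (Φ δ) b c := by
      obtain ⟨z, ⟨hz1, hz2⟩, hz3, hz4⟩ := ((key.and hzb).and hnj₁).exists.imp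
        fun z hz => (⟨hz.1, hz.2, trivial⟩ : (_ ∧ _) ∧ _ ∧ True)
      exact (((hz1 c hc.1 hc.2.1 hc.2.2).mono hR hR₁ h₁.le).split hR₁ hz2.1 (hbC c hc).1 hz2.2
        (hbC c hc).2).resolve_left hz3
    refine hb (hS'.not_gap hC hG hG₁ hgap₁ hj ⟨hj.1, hj.2.1, fun x h2 h3 => ?_⟩).1
    rcases (h₁.dom x).1 (hR₁.right h2) with hx | rfl
    · have h4 : R x c := hR.of_le hR₁ h₁.le hx hc.1 h3
      exact Or.inr (hR.antisymm h4 (hcmin x ⟨hx, (hbr x hx).1 h2, hR.trans h4 hc.2.2⟩))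
    · exact Or.inl rfl
  -- otherwise insert, above `b`, a limit `c` from above
  push Not at hmin
  have hCp : C p.2 := ⟨hp2R, hp2, hp2R⟩
  obtain ⟨V, hV⟩ : ∃ V : Ultrafilter T, ∀ w, C w → ∀ᶠ w' in V, C w' ∧ R w' w ∧ w' ≠ w := by
    have : Nonempty T := ⟨b⟩
    have : Nonempty {w // C w} := ⟨⟨p.2, hCp⟩⟩
    let F : {w // C w} → Filter T := fun w => 𝓟 {w' | C w' ∧ R w' w.1 ∧ w' ≠ w.1}
    have hF : (⨅ w, F w).NeBot := by
      refine iInf_neBot_of_directed (fun w₁ w₂ => ?_) fun w => ?_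
      · rcases hR.total w₁.2.1 w₂.2.1 with h | h
        · refine ⟨w₁, le_rfl, principal_mono.2 fun w' hw' => ⟨hw'.1, hR.trans hw'.2.1 h, ?_⟩⟩
          rintro rfl
          exact hw'.2.2 (hR.antisymm hw'.2.1 h)
        · refine ⟨w₂, principal_mono.2 fun w' hw' => ⟨hw'.1, hR.trans hw'.2.1 h, ?_⟩, le_rfl⟩
          rintro rfl
          exact hw'.2.2 (hR.antisymm hw'.2.1 h)
      · obtain ⟨w', hw', hn⟩ := hmin w.1 w.2
        refine principal_neBot_iff.2 ⟨w', hw', (hR.total hw'.1 w.2.1).resolve_right hn, ?_⟩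
        rintro rfl
        exact hn hw'.1
    refine ⟨@Ultrafilter.of _ _ hF, fun w hw => ?_⟩
    exact (@Ultrafilter.of_le _ _ hF).trans (iInf_le F ⟨w, hw⟩) (mem_principal_self _)
  have hVC := (hV _ hCp).mono fun _ h => h.1
  have hVR : ∀ᶠ w in V, R₁ w w := hVC.mono fun w hw => h₁.le _ _ hw.1
  obtain ⟨c, R₂, hG₂, h₂⟩ := hC.ext R₁ hG₁ V hVR
  have hR₂ := hC.lin hG₂
  have hcc : R₂ c c := (h₂.dom c).2 (Or.inr rfl)
  have hc : ¬ R₁ c c := by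
    intro hc
    have h3 := ((h₂.left c hc).1 hcc).and ((h₂.right c hc).1 hcc)
    obtain ⟨w, hw, hwC⟩ := (h3.and hVC).exists
    have hCc : C c := hR₁.antisymm hw.1 hw.2 ▸ hwC
    obtain ⟨w', hw', hwC'⟩ := (h3.and (hV c hCc)).exists
    exact hwC'.2.2 (hR₁.antisymm hw'.2 hw'.1)
  have hbc : R₂ b c := (h₂.left b hbb).2 (hVC.mono fun w hw => (hbC w hw).1)
  have hbc' : b ≠ c := fun e => hc (e ▸ hbb)
  have hcw : ∀ w, C w → R₂ c w ∧ c ≠ w := fun w hw =>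
    ⟨(h₂.right w (h₁.le _ _ hw.1)).2 ((hV w hw).mono fun w' hw' => h₁.le _ _ hw'.2.1),
      fun e => hc (e ▸ h₁.le _ _ hw.1)⟩
  have hnj₂ : ∀ᶠ w in V, ¬ Jump R₂ (Φ δ) c w := by
    refine (h₂.swap.not_jump (δ := δ) hR₁.swap hR₂.swap hVR (hB _ (hC.swap hG₁))).mono ?_
    exact fun w hw hj => hw (hj.swap hR₂)
  have hj : Jump R₂ (Φ δ) b c := by
    obtain ⟨z, ⟨⟨hz1, hz2⟩, hz3⟩, hz4⟩ := (((key.and hzb).and hnj₁).and hlt).exists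
    obtain ⟨w, hw1, hw2⟩ := (hnj₂.and hVC).exists
    have h3 : Jump R₂ (Φ δ) z w :=
      ((hz1 w hw2.1 hw2.2.1 hw2.2.2).mono hR hR₁ h₁.le).mono hR₁ hR₂ h₂.le
    have h4 := (h3.split hR₂ (h₂.le _ _ hz2.1) (h₂.le _ _ (hbC w hw2).1) hz2.2
      (hbC w hw2).2).resolve_left
        fun h => hz3 (h₂.jump_of_jump hR₁ hR₂ hVR hc (hR₁.left hz2.1) hbb h)
    exact (h4.split hR₂ hbc (hcw w hw2).1 hbc' (hcw w hw2).2).resolve_right hw1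
  refine hb (hS'.not_gap hC hG hG₂ (hgap₁.trans hR hR₁ (h₂.gapLe hR₁ hR₂ hc)) hj
    ⟨hj.1, hj.2.1, fun x h3 h4 => ?_⟩).1
  rcases (h₂.dom x).1 (hR₂.right h3) with hx | rfl
  · rcases (h₁.dom x).1 hx with hx' | rfl
    · exfalso
      have h5 : ∀ᶠ w in V, R₁ x w := (h₂.left x hx).1 h4
      obtain ⟨w, hw1, hw2⟩ := (h5.and hVC).exists
      have hxC : C x := ⟨hx', (hbr x hx').1 (hR₁.of_le hR₂ h₂.le hbb hx h3),
        hR.trans (hR.of_le hR₁ h₁.le hx' hw2.1 hw1) hw2.2.2⟩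
      obtain ⟨w', hw1', hw2'⟩ := (h5.and (hV x hxC)).exists
      exact hw2'.2.2 (hR₁.antisymm (h₁.le _ _ hw2'.2.1) hw1')
    · exact Or.inl rfl
  · exact Or.inr rfl

/-- In a class with the above closure properties every member has an extension `R` such that in all
further extensions no element `v` is separated by a jump from those elements of `R` whose limit
it is. -/
theorem IsLimClass.exists_extension [Nonempty Δ] (hC : IsLimClass Φ Good) (hG : Good R) :
    ∃ R₁, R ≤ R₁ ∧ Good R₁ ∧ ∀ R', Good R' → R₁ ≤ R' → ∀ (v : T) (U : Ultrafilter T),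
      (∀ᶠ z in U, R₁ z z) → (∀ x, R₁ x x → (R' x v ↔ ∀ᶠ z in U, R₁ x z)) →
      (∀ x, R₁ x x → (R' v x ↔ ∀ᶠ z in U, R₁ z x)) → ∀ δ,
      ∀ᶠ z in U, ¬ Jump R' (Φ δ) z v ∧ ¬ Jump R' (Φ δ) v z := by
  obtain ⟨⟨R₀, hG₀⟩, hle₀, hS₀⟩ := exists_stable (E := {R // Good R}) (D := Δ × ℕ)
    (fun a b => a.1 ≤ b.1) (fun _ => le_rfl) (fun h h' => le_trans h h')
    (fun g hg => ⟨⟨⨆ d, (g d).1, hC.chain _ (fun d => (g d).2) hg⟩,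
      fun d => le_iSup (fun d => (g d).1) d⟩)
    (fun d R => HasJumps d.2 R.1 (Φ d.1))
    (fun d a b hab h => h.mono (hC.lin a.2) (hC.lin b.2) hab) ⟨R, hG⟩
  have hS₀' : JumpStable Φ Good R₀ := fun δ K R' hG' hle h => hS₀ ⟨R', hG'⟩ hle (δ, K) h
  obtain ⟨⟨R₁, hG₁⟩, hle₁, hS₁⟩ := exists_stable (E := {R // Good R}) (D := Δ × ℕ)
    (fun a b => GapLe Φ a.1 b.1) (fun _ => GapLe.refl _)
    (fun {a b c} h h' => h.trans (hC.lin a.2) (hC.lin b.2) h')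
    (fun g hg => by
      have hGs := hC.chain (fun d => (g d).1) (fun d => (g d).2)
        (fun d d' => (hg d d').imp And.left And.left)
      refine ⟨⟨⨆ d, (g d).1, hGs⟩, fun d => ⟨le_iSup (fun d => (g d).1) d, ?_⟩⟩
      intro δ x y hj hc
      refine ⟨le_iSup (fun d => (g d).1) d _ _ hc.1, hc.2.1, fun z h1 h2 => ?_⟩
      -- an element between `x` and `y` already occurs between them in a member of the chain
      have hsup : ∀ a b, (⨆ d, (g d).1) a b → ∃ d, (g d).1 a b := fun a b h => by
        simpa only [iSup_apply, iSup_Prop_eq] using h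
      obtain ⟨d', hz⟩ := hsup z z ((hC.lin hGs).right h1)
      have hd : ∃ d'', GapLe Φ (g d).1 (g d'').1 ∧ (g d'').1 z z := by
        rcases hg d d' with h | h
        · exact ⟨d', h, hz⟩
        · exact ⟨d, GapLe.refl _, h.1 _ _ hz⟩
      obtain ⟨d'', hle, hz⟩ := hd
      have hc' := hle.2 δ x y hj hc
      have hl := hC.lin (g d'').2
      have hle' : (g d'').1 ≤ ⨆ d, (g d).1 := le_iSup (fun d => (g d).1) d''
      exact hc'.2.2 z (hl.of_le (hC.lin hGs) hle' (hl.left hc'.1) hz h1)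
        (hl.of_le (hC.lin hGs) hle' hz (hl.right hc'.1) h2))
    (fun d R => HasGaps d.2 R.1 (Φ d.1))
    (fun d a b hab h => h.mono (hC.lin a.2) (hC.lin b.2) hab) ⟨R₀, hG₀⟩
  have hS : JumpStable Φ Good R₁ := fun δ K R' hG' hle h =>
    (hS₀' δ K R' hG' (hle₁.1.trans hle) h).mono (hC.lin hG₀) (hC.lin hG₁) hle₁.1
  have hS' : GapStable Φ Good R₁ := fun δ K R' hG' hle h => hS₁ ⟨R', hG'⟩ hle (δ, K) h
  refine ⟨R₁, hle₀.trans hle₁.1, hG₁, fun R' hG' hle v U hU hl hr δ => ?_⟩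
  refine (not_jump_of_stable hC hG₁ hS hS' hG' hle hU hl hr δ).and ?_
  refine (not_jump_of_stable hC (hC.swap hG₁) (hS.swap hC hG₁) (hS'.swap hC hG₁) (hC.swap hG')
    (fun _ _ h => hle _ _ h) hU hr hl δ).mono ?_
  exact fun z hz hj => hz (hj.swap (hC.lin hG'))

end Main

namespace MSLanguage

open Filter

variable {S : Type u} {L : MSLanguage S} (M : L.Str) {m : ℕ} (σ : Fin m → S)

/-- Tuples of elements of `M` of the sorts `σ`. -/
abbrev Str.Tup : Type u := ∀ k, M.carrier (σ k)

variable {M σ}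

/-- The family `f` of tuples, as an assignment. -/
def Str.flat {ν : Type*} (f : ν → M.Tup σ) : ∀ p : ν × Fin m, M.carrier (σ p.2) :=
  fun p => f p.1 p.2

variable (M σ) in
/-- The set `D` of assignments is defined in `M` by a formula with parameters in `B`. -/
def Str.DfnOver (B : Set M.Elem) {α : Type x} (σ : α → S) (D : (∀ a, M.carrier (σ a)) → Prop) :
    Prop :=
  ∃ φ : M.FormulaOver B σ, ∀ v, M.Holds φ v ↔ D v

theorem Str.Dfn.dfnOver {α : Type x} {σ : α → S} {D : (∀ a, M.carrier (σ a)) → Prop}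
    (h : M.Dfn σ D) (B : Set M.Elem) : M.DfnOver B σ D := by
  obtain ⟨φ, hφ⟩ := h
  refine ⟨φ.substFree fun a => .var (σ := Sum.elim σ fun b : B => b.1.1) (.inl a), fun v => ?_⟩
  exact (Formula.realize_substFree M φ _ _).trans (hφ v)

/-- The sequence of tuples which is given by the linear order `R` is indiscernible: definable sets
do not distinguish between finite families of members of the same order type. -/
def Str.IsIndRel (M : L.Str) {σ : Fin m → S} (R : M.Tup σ → M.Tup σ → Prop) : Prop :=
  ∀ (ν : Type) [Finite ν] (D : (∀ p : ν × Fin m, M.carrier (σ p.2)) → Prop),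
    M.Dfn (fun p : ν × Fin m => σ p.2) D → ∀ f g : ν → M.Tup σ, (∀ i, R (f i) (f i)) →
      (∀ i, R (g i) (g i)) → (∀ i j, R (f i) (f j) ↔ R (g i) (g j)) → D (Str.flat f) →
        D (Str.flat g)

/-! ### Limits of tuples -/

/-- The tuple at which a limit of tuples is evaluated: each of its members is either an element of
`R` or one of the members of `f`. -/
def evalCode {T : Type u} {R : T → T → Prop} {n : ℕ} (f : Fin n → T) : {a // R a a} ⊕ Fin n → T
  | .inl a => a.1
  | .inr i => f i

/-- If `v` realises the limit of types along `U` over a set which contains the coordinates of the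
elements of `R`, then the same holds for tuples composed of `v` and of elements of `R`. -/
theorem lim_evalCode {R : M.Tup σ → M.Tup σ → Prop} {A B : Set M.Elem} (hBA : B ⊆ A)
    (hRA : ∀ (a : M.Tup σ) k, R a a → (⟨σ k, a k⟩ : M.Elem) ∈ A) {n : ℕ}
    {U : Ultrafilter (Fin n → M.Tup σ)} {v : Fin n → M.Tup σ}
    (hv : ∀ ψ : M.FormulaOver A (fun p : Fin n × Fin m => σ p.2),
      M.Holds ψ (Str.flat v) ↔ ∀ᶠ f in U, M.Holds ψ (Str.flat f))
    {ν : Type} {D : (∀ p : ν × Fin m, M.carrier (σ p.2)) → Prop}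
    (hD : M.DfnOver B (fun p : ν × Fin m => σ p.2) D) (c : ν → {a // R a a} ⊕ Fin n) :
    D (Str.flat fun j => evalCode v (c j)) ↔ ∀ᶠ f in U, D (Str.flat fun j => evalCode f (c j)) := by
  obtain ⟨ψ, hψ⟩ := hD
  have ht : ∀ p : ν × Fin m, ∃ t : Term L (Sum.elim (fun p : Fin n × Fin m => σ p.2)
      fun a : A => a.1.1) (σ p.2), ∀ f : Fin n → M.Tup σ,
      t.realize M (M.glue (Str.flat f) fun a : A => a.1.2) = evalCode f (c p.1) p.2 := by
    rintro ⟨j, k⟩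
    rcases hc : c j with a | i
    · refine ⟨.var (σ := Sum.elim (fun p : Fin n × Fin m => σ p.2) fun a : A => a.1.1)
        (.inr ⟨⟨σ k, a.1 k⟩, hRA _ _ a.2⟩), fun f => ?_⟩
      simp only
      rfl
    · refine ⟨.var (σ := Sum.elim (fun p : Fin n × Fin m => σ p.2) fun a : A => a.1.1)
        (.inl (i, k)), fun f => ?_⟩
      simp only
      rfl
  choose t ht using ht
  let t' : ∀ q : (ν × Fin m) ⊕ B, Term L (Sum.elim (fun p : Fin n × Fin m => σ p.2)
      fun a : A => a.1.1) (Sum.elim (fun p : ν × Fin m => σ p.2) (fun b : B => b.1.1) q) := fun q =>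
    match q with
    | .inl p => t p
    | .inr b => .var (σ := Sum.elim (fun p : Fin n × Fin m => σ p.2) fun a : A => a.1.1)
        (.inr ⟨b.1, hBA b.2⟩)
  have key : ∀ f : Fin n → M.Tup σ, M.Holds (A := A) (Formula.substFree ψ t') (Str.flat f) ↔
      D (Str.flat fun j => evalCode f (c j)) := by
    intro f
    rw [← hψ, Str.Holds, Formula.realize_substFree, Str.Holds]
    apply Eq.to_iff
    congr 1
    funext q
    rcases q with p | b
    · exact ht p f
    · rfl
  rw [← key, hv]
  exact eventually_congr (Eventually.of_forall key)

/-- A limit `v` of tuples of members of an indiscernible sequence can be inserted into this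
sequence. -/
theorem exists_insert {R : M.Tup σ → M.Tup σ → Prop} (hR : IsLin R) (hI : M.IsIndRel R) {n : ℕ}
    {U : Ultrafilter (Fin n → M.Tup σ)} (hU : ∀ᶠ f : Fin n → M.Tup σ in U, ∀ i, R (f i) (f i))
    {v : Fin n → M.Tup σ}
    (hv : ∀ {ν : Type} [Finite ν] {D : (∀ p : ν × Fin m, M.carrier (σ p.2)) → Prop},
      M.Dfn (fun p : ν × Fin m => σ p.2) D → ∀ c : ν → {a // R a a} ⊕ Fin n,
      (D (Str.flat fun j => evalCode v (c j)) ↔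
        ∀ᶠ f in U, D (Str.flat fun j => evalCode f (c j)))) :
    ∃ R', IsLin R' ∧ M.IsIndRel R' ∧ R ≤ R' ∧ (∀ a, R' a a ↔ ∃ c, evalCode (R := R) v c = a) ∧
      ∀ c d : {a // R a a} ⊕ Fin n, R' (evalCode v c) (evalCode v d) ↔
        ∀ᶠ f in U, R (evalCode f c) (evalCode f d) := by
  have heq : ∀ c d : {a // R a a} ⊕ Fin n, evalCode v c = evalCode v d →
      ∀ᶠ f in U, evalCode f c = evalCode f d := by
    intro c d hcd
    have hD : M.Dfn (fun p : Bool × Fin m => σ p.2) (fun w => ∀ k, w (true, k) = w (false, k)) :=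
      Str.Dfn.forall_finite fun k => Str.Dfn.equal M
        (.var (σ := fun p : Bool × Fin m => σ p.2) (true, k))
        (.var (σ := fun p : Bool × Fin m => σ p.2) (false, k))
    have := (hv hD fun b => cond b c d).1 fun k => congrFun hcd k
    exact this.mono fun f hf => funext hf
  have hdom : ∀ c : {a // R a a} ⊕ Fin n, ∀ᶠ f in U, R (evalCode f c) (evalCode f c) := by
    rintro (a | i)
    · exact Eventually.of_forall fun _ => a.2
    · exact hU.mono fun f hf => hf i
  let R' : M.Tup σ → M.Tup σ → Prop := fun a b => ∃ c d : {a // R a a} ⊕ Fin n,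
    evalCode v c = a ∧ evalCode v d = b ∧ ∀ᶠ f in U, R (evalCode f c) (evalCode f d)
  have hR' : ∀ c d : {a // R a a} ⊕ Fin n, R' (evalCode v c) (evalCode v d) ↔
      ∀ᶠ f in U, R (evalCode f c) (evalCode f d) := by
    refine fun c d => ⟨?_, fun h => ⟨c, d, rfl, rfl, h⟩⟩
    rintro ⟨c', d', hc, hd, h⟩
    filter_upwards [heq _ _ hc, heq _ _ hd, h] with f h1 h2 h3
    rwa [← h1, ← h2]
  have hcode : ∀ a, R' a a ↔ ∃ c, evalCode (R := R) v c = a := by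
    refine fun a => ⟨?_, ?_⟩
    · rintro ⟨c, d, hc, -⟩
      exact ⟨c, hc⟩
    · rintro ⟨c, rfl⟩
      exact (hR' c c).2 (hdom c)
  refine ⟨R', ?_, ?_, ?_, hcode, hR'⟩
  · refine ⟨?_, ?_, ?_, ?_, ?_⟩
    · rintro a b ⟨c, d, rfl, rfl, h⟩
      exact (hR' c c).2 (hdom c)
    · rintro a b ⟨c, d, rfl, rfl, h⟩
      exact (hR' d d).2 (hdom d)
    · rintro a b e ⟨c, d, rfl, rfl, h⟩ ⟨c', d', hc, rfl, h'⟩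
      refine ⟨c, d', rfl, rfl, ?_⟩
      filter_upwards [h, h', heq _ _ hc] with f h1 h2 h3
      exact hR.trans h1 (h3 ▸ h2)
    · rintro a b ⟨c, d, rfl, rfl, h⟩ h'
      have h1 := (hR' d c).1 h'
      have hD : M.Dfn (fun p : Bool × Fin m => σ p.2) (fun w => ∀ k, w (true, k) = w (false, k)) :=
        Str.Dfn.forall_finite fun k => Str.Dfn.equal M
          (.var (σ := fun p : Bool × Fin m => σ p.2) (true, k))
          (.var (σ := fun p : Bool × Fin m => σ p.2) (false, k))
      refine funext ((hv hD fun b => cond b c d).2 ?_)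
      filter_upwards [h, h1] with f h2 h3 k
      exact congrFun (hR.antisymm h2 h3) k
    · intro a b ha hb
      obtain ⟨c, rfl⟩ := (hcode a).1 ha
      obtain ⟨d, rfl⟩ := (hcode b).1 hb
      rw [hR', hR', ← Ultrafilter.eventually_or]
      filter_upwards [hdom c, hdom d] with f h1 h2
      exact hR.total h1 h2
  · intro ν _ D hD f g hf hg hfg hDf
    choose c hc using fun i => (hcode _).1 (hf i)
    choose d hd using fun i => (hcode _).1 (hg i)
    obtain rfl : (fun i => evalCode v (c i)) = f := funext hc
    obtain rfl : (fun i => evalCode v (d i)) = g := funext hd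
    rw [hv hD] at hDf ⊢
    have h1 : ∀ᶠ w in U, ∀ i j, R (evalCode w (c i)) (evalCode w (c j)) ↔
        R (evalCode w (d i)) (evalCode w (d j)) := by
      rw [eventually_all]
      intro i
      rw [eventually_all]
      intro j
      have h2 := hfg i j
      rw [hR', hR'] at h2
      by_cases h3 : ∀ᶠ w in U, R (evalCode w (c i)) (evalCode w (c j))
      · filter_upwards [h3, h2.1 h3] with w h4 h5
        exact iff_of_true h4 h5
      · have h3' := h3
        rw [h2] at h3'
        rw [← Ultrafilter.eventually_not] at h3 h3'
        filter_upwards [h3, h3'] with w h4 h5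
        exact iff_of_false h4 h5
    have h2 : ∀ᶠ w in U, ∀ i, R (evalCode w (c i)) (evalCode w (c i)) :=
      eventually_all.2 fun i => hdom (c i)
    have h3 : ∀ᶠ w in U, ∀ i, R (evalCode w (d i)) (evalCode w (d i)) :=
      eventually_all.2 fun i => hdom (d i)
    filter_upwards [hDf, h1, h2, h3] with w h4 h5 h6 h7
    exact hI ν D hD _ _ h6 h7 h5 h4
  · intro a b hab
    exact (hR' (.inl ⟨a, hR.left hab⟩) (.inl ⟨b, hR.right hab⟩)).2
      (Eventually.of_forall fun _ => hab)

/-- In a saturated pair the limits along ultrafilters of tuples from the predicate are realised by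
tuples from the predicate. -/
theorem exists_lim {P : ∀ s, Set (M.carrier s)} {κ : Cardinal.{u}}
    (hκ : (M.pair P).IsSaturated κ) {A : Set M.Elem} (hA : #A < κ) {α : Type} [Finite α]
    {ρ : α → S} (U : Ultrafilter (∀ a, M.carrier (ρ a)))
    (hU : ∀ᶠ w : (∀ a, M.carrier (ρ a)) in U, ∀ a, w a ∈ P (ρ a)) :
    ∃ v : ∀ a, M.carrier (ρ a), (∀ a, v a ∈ P (ρ a)) ∧
      ∀ ψ : M.FormulaOver A ρ, M.Holds ψ v ↔ ∀ᶠ w in U, M.Holds ψ w := by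
  classical
  obtain ⟨n, ⟨e'⟩⟩ := Finite.exists_equiv_fin α
  let e := e'.symm
  let p : Set ((M.pair P).FormulaOver (A := A) (fun i : Fin n => ρ (e i))) :=
    {χ | ∀ᶠ w : (∀ a, M.carrier (ρ a)) in U, (M.pair P).Holds (A := A) χ (fun i => w (e i))}
  obtain ⟨v', hv'⟩ := hκ A hA n (fun i => ρ (e i)) p (by
    intro p₀ hp₀ hfin
    have h1 : ∀ᶠ w : (∀ a, M.carrier (ρ a)) in U, ∀ χ ∈ p₀,
        (M.pair P).Holds (A := A) χ (fun i => w (e i)) :=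
      (eventually_all_finite hfin).2 fun χ hχ => hp₀ hχ
    obtain ⟨w, hw⟩ := h1.exists
    exact ⟨fun i => w (e i), trivial, hw⟩)
  obtain ⟨v, rfl⟩ : ∃ v : ∀ a, M.carrier (ρ a), (fun i => v (e i)) = v' :=
    ⟨Equiv.piCongrLeft (fun a => M.carrier (ρ a)) e v',
      funext fun i => Equiv.piCongrLeft_apply_apply (fun a => M.carrier (ρ a)) e v' i⟩
  have ht : ∀ a : α, ∃ t : Term L (Sum.elim (fun i : Fin n => ρ (e i)) fun a : A => a.1.1) (ρ a),
      ∀ w : ∀ a, M.carrier (ρ a), t.realize M (M.glue (fun i => w (e i)) fun a : A => a.1.2) =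
        w a := by
    intro a
    obtain ⟨i, rfl⟩ := e.surjective a
    exact ⟨.var (σ := Sum.elim (fun i : Fin n => ρ (e i)) fun a : A => a.1.1) (.inl i),
      fun w => rfl⟩
  choose t ht using ht
  let t' : ∀ q : α ⊕ A, Term L (Sum.elim (fun i : Fin n => ρ (e i)) fun a : A => a.1.1)
      (Sum.elim ρ (fun a : A => a.1.1) q) := fun q =>
    match q with
    | .inl a => t a
    | .inr a => .var (σ := Sum.elim (fun i : Fin n => ρ (e i)) fun a : A => a.1.1) (.inr a)
  have key : ∀ (ψ : M.FormulaOver A ρ) (w : ∀ a, M.carrier (ρ a)),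
      (M.pair P).Holds (A := A) (BoundedFormula.toP (Formula.substFree ψ t'))
        (fun i => w (e i)) ↔ M.Holds ψ w := by
    intro ψ w
    have h1 : (Str.glue (M.pair P) (fun i => w (e i)) fun a : A => a.1.2) =
        M.glue (fun i => w (e i)) fun a : A => a.1.2 := by
      funext q
      rcases q with i | a <;> rfl
    refine (Eq.to_iff (congrArg (Formula.Realize (L := L.withP)
      (BoundedFormula.toP (Formula.substFree ψ t')) (M.pair P)) h1)).trans ?_
    refine (Formula.realize_toP M P _ _).trans ((Formula.realize_substFree M ψ t' _).trans ?_)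
    refine Eq.to_iff (congrArg (Formula.Realize ψ M) (funext fun q => ?_))
    rcases q with a | a
    · exact ht a w
    · rfl
  have hmem : ∀ ψ : M.FormulaOver A ρ, (∀ᶠ w in U, M.Holds ψ w) → M.Holds ψ v := fun ψ hψ =>
    (key ψ v).1 (hv' _ (hψ.mono fun w hw => (key ψ w).2 hw))
  refine ⟨v, fun a => ?_, fun ψ => ⟨fun h => ?_, hmem ψ⟩⟩
  · obtain ⟨i, rfl⟩ := e.surjective a
    let χ : (M.pair P).FormulaOver (A := A) (fun i : Fin n => ρ (e i)) :=
      .rel (L := L.withP) (d := fun _ : Fin 1 => ρ (e i)) (.inr (.P (ρ (e i)))) fun _ =>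
        .var (σ := Sum.elim (Sum.elim (fun i : Fin n => ρ (e i)) fun a : A => a.1.1) Fin.elim0)
          (.inl (.inl i))
    exact hv' χ (hU.mono fun w hw => hw (e i))
  · by_contra hcon
    rw [← Ultrafilter.eventually_not] at hcon
    exact hmem (Formula.not ψ) hcon h

end MSLanguage

namespace MSLanguage

open Filter

variable {S : Type u} {L : MSLanguage S} {M : L.Str} {m : ℕ} {σ : Fin m → S}

/-! ### Boundedly many jumps -/

/-- NIP for variables indexed by arbitrary finite types. -/
theorem Theory.IsNIP.exists_bound {T : L.Theory} (hT : T.IsNIP) (hM : M.Models T) {α : Type}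
    [Finite α] {l : ℕ} {ρ : α → S} {τ : Fin l → S} (φ : L.Formula (Sum.elim ρ τ)) :
    ∃ n : ℕ, ¬ ∃ (a : Fin n → ∀ i, M.carrier (ρ i)) (b : Set (Fin n) → ∀ j, M.carrier (τ j)),
        ∀ (i : Fin n) (s : Set (Fin n)), φ.Realize M (M.glue (a i) (b s)) ↔ i ∈ s := by
  obtain ⟨k, ⟨e'⟩⟩ := Finite.exists_equiv_fin α
  let e := e'.symm
  have ht : ∀ q : α ⊕ Fin l, ∃ t : Term L (Sum.elim (fun i : Fin k => ρ (e i)) τ) (Sum.elim ρ τ q),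
      ∀ (v : ∀ a, M.carrier (ρ a)) (w : ∀ j, M.carrier (τ j)),
        t.realize M (M.glue (fun i => v (e i)) w) = M.glue v w q := by
    rintro (a | j)
    · obtain ⟨i, rfl⟩ := e.surjective a
      exact ⟨.var (σ := Sum.elim (fun i : Fin k => ρ (e i)) τ) (.inl i), fun v w => rfl⟩
    · exact ⟨.var (σ := Sum.elim (fun i : Fin k => ρ (e i)) τ) (.inr j), fun v w => rfl⟩
  choose t ht using ht
  obtain ⟨n, hn⟩ := hT k l (fun i => ρ (e i)) τ (φ.substFree t)
  refine ⟨n, fun ⟨a, b, hab⟩ => hn M hM ⟨fun j i => a j (e i), b, fun i s => ?_⟩⟩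
  rw [Formula.realize_substFree, ← hab i s]
  simp only [ht]

/-- In a model of an NIP theory, the truth value of a formula with parameters jumps only boundedly
many times on indiscernible sequences. -/
theorem exists_jump_bound {T : L.Theory} (hT : T.IsNIP) (hM : M.Models T) {B : Set M.Elem} {n : ℕ}
    (φ : M.FormulaOver B (fun p : Fin n × Fin m => σ p.2)) :
    ∃ K, ∀ R : M.Tup σ → M.Tup σ → Prop, IsLin R → M.IsIndRel R →
      ¬ HasJumps K R (fun s => M.Holds φ (Str.flat s)) := by
  obtain ⟨l, g, ψ, hψ⟩ := Formula.exists_fin_params φ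
  obtain ⟨h, hh⟩ := hT.exists_bound hM ψ
  refine ⟨(2 * (4 * n) + 1) * h, fun R hR hI hj => hh ?_⟩
  obtain ⟨s, hs, hΦ, hord⟩ := hj.exists_independent hR le_rfl
  -- all patterns are realised, since the tuples can be exchanged independently of each other
  have key : ∀ X : Set (Fin h), ∃ w : ∀ j, M.carrier ((g j).1.1),
      ∀ i, ψ.Realize M (M.glue (Str.flat (s true i)) w) ↔ i ∈ X := by
    intro X
    let E : (∀ p : (Fin h × Fin n) × Fin m, M.carrier (σ p.2)) →
        (∀ j, M.carrier ((g j).1.1)) → Prop := fun v w => ∀ i,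
      (ψ.Realize M (M.glue (fun p : Fin n × Fin m => v ((i, p.1), p.2)) w) ↔ i ∈ X)
    have hE : M.Dfn (fun p : (Fin h × Fin n) × Fin m => σ p.2) (fun v => ∃ w, E v w) := by
      refine Str.Dfn.exists_fin (τ := fun j => (g j).1.1) (D := E) ?_
      refine Str.Dfn.forall_finite fun i => ?_
      have h1 : M.Dfn (Sum.elim (fun p : (Fin h × Fin n) × Fin m => σ p.2) fun j => (g j).1.1)
          (fun v => ψ.Realize M
            (M.glue (fun p : Fin n × Fin m => v (Sum.inl ((i, p.1), p.2)))
              fun j => v (Sum.inr j))) := by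
        let t : ∀ q : (Fin n × Fin m) ⊕ Fin l,
            Term L (Sum.elim (fun p : (Fin h × Fin n) × Fin m => σ p.2) fun j => (g j).1.1)
              (Sum.elim (fun p : Fin n × Fin m => σ p.2) (fun j => (g j).1.1) q) := fun q =>
          match q with
          | .inl p => .var (σ := Sum.elim (fun p : (Fin h × Fin n) × Fin m => σ p.2)
              fun j => (g j).1.1) (.inl ((i, p.1), p.2))
          | .inr j => .var (σ := Sum.elim (fun p : (Fin h × Fin n) × Fin m => σ p.2)
              fun j => (g j).1.1) (.inr j)
        refine (Str.Dfn.preimage (D := fun v => ψ.Realize M v) ⟨ψ, fun v => Iff.rfl⟩ t).congr ?_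
        intro v
        apply Eq.to_iff
        congr 1
        funext q
        rcases q with p | j <;> rfl
      by_cases hi : i ∈ X
      · exact h1.congr fun v => by simp [hi]
      · exact h1.not.congr fun v => by simp [hi]
    have he : ∀ i, ∃ e, M.Holds φ (Str.flat (s e i)) ↔ i ∈ X := by
      intro i
      have := hΦ i
      by_cases h1 : M.Holds φ (Str.flat (s true i)) ↔ i ∈ X
      · exact ⟨true, h1⟩
      · exact ⟨false, by tauto⟩
    choose e he using he
    have h2 := hI (Fin h × Fin n) _ hE (fun p => s (e p.1) p.1 p.2) (fun p => s true p.1 p.2)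
      (fun p => hs _ _ _) (fun p => hs _ _ _) (fun p q => hord e p.1 q.1 p.2 q.2)
      ⟨fun j => (g j).1.2, fun i => (hψ M _ _).symm.trans (he i)⟩
    exact h2
  choose w hw using key
  exact ⟨fun i => Str.flat (s true i), w, fun i X => hw X i⟩

/-! ### Small indiscernible sequences -/

/-- Indiscernible sequences of at most `c` tuples from `P`. -/
structure Str.IsGood (M : L.Str) {σ : Fin m → S} (P : ∀ s, Set (M.carrier s)) (c : Cardinal.{u})
    (R : M.Tup σ → M.Tup σ → Prop) : Prop where
  lin : IsLin R
  ind : M.IsIndRel R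
  mem : ∀ a, R a a → ∀ k, a k ∈ P (σ k)
  card : #{a // R a a} ≤ c

theorem Str.IsGood.swap {P : ∀ s, Set (M.carrier s)} {c : Cardinal.{u}}
    {R : M.Tup σ → M.Tup σ → Prop} (h : M.IsGood P c R) : M.IsGood P c (Function.swap R) where
  lin := h.lin.swap
  ind := fun ν _ D hD f g hf hg hfg => h.ind ν D hD f g hf hg fun i j => hfg j i
  mem := h.mem
  card := h.card

theorem Str.IsGood.iSup {P : ∀ s, Set (M.carrier s)} {c : Cardinal.{u}} (hc : ℵ₀ ≤ c) {D : Type u}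
    [Nonempty D] (hD : #D ≤ c) {g : D → M.Tup σ → M.Tup σ → Prop} (hg : ∀ d, M.IsGood P c (g d))
    (hch : ∀ d d', g d ≤ g d' ∨ g d' ≤ g d) : M.IsGood P c (⨆ d, g d) := by
  have hsup : ∀ a b, (⨆ d, g d) a b ↔ ∃ d, g d a b := fun a b => by
    simp only [iSup_apply, iSup_Prop_eq]
  have hdir : Directed (· ≤ ·) g := fun d d' => (hch d d').elim
    (fun h => ⟨d', h, le_rfl⟩) fun h => ⟨d, le_rfl, h⟩
  have hfin : ∀ {ν : Type} [Finite ν] (f : ν → M.Tup σ), (∀ i, (⨆ d, g d) (f i) (f i)) →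
      ∃ d, ∀ i, g d (f i) (f i) := by
    intro ν _ f hf
    choose d hd using fun i => (hsup _ _).1 (hf i)
    obtain ⟨d', hd'⟩ := hdir.finite_le d
    exact ⟨d', fun i => hd' i _ _ (hd i)⟩
  have hle : ∀ d, g d ≤ ⨆ d, g d := le_iSup g
  have hlin : IsLin (⨆ d, g d) := by
    refine ⟨?_, ?_, ?_, ?_, ?_⟩
    · intro a b h
      obtain ⟨d, hd⟩ := (hsup _ _).1 h
      exact hle d _ _ ((hg d).lin.left hd)
    · intro a b h
      obtain ⟨d, hd⟩ := (hsup _ _).1 h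
      exact hle d _ _ ((hg d).lin.right hd)
    · intro a b e h h'
      obtain ⟨d, hd⟩ := (hsup _ _).1 h
      obtain ⟨d', hd'⟩ := (hsup _ _).1 h'
      obtain ⟨d'', h1, h2⟩ := hdir d d'
      exact hle d'' _ _ ((hg d'').lin.trans (h1 _ _ hd) (h2 _ _ hd'))
    · intro a b h h'
      obtain ⟨d, hd⟩ := (hsup _ _).1 h
      obtain ⟨d', hd'⟩ := (hsup _ _).1 h'
      obtain ⟨d'', h1, h2⟩ := hdir d d'
      exact (hg d'').lin.antisymm (h1 _ _ hd) (h2 _ _ hd')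
    · intro a b h h'
      obtain ⟨d, hd⟩ := (hsup _ _).1 h
      obtain ⟨d', hd'⟩ := (hsup _ _).1 h'
      obtain ⟨d'', h1, h2⟩ := hdir d d'
      exact ((hg d'').lin.total (h1 _ _ hd) (h2 _ _ hd')).imp (hle d'' _ _) (hle d'' _ _)
  refine ⟨hlin, ?_, ?_, ?_⟩
  · intro ν _ E hE f f' hf hf' hff' hEf
    obtain ⟨d, hd⟩ := hfin f hf
    obtain ⟨d', hd'⟩ := hfin f' hf'
    obtain ⟨d'', h1, h2⟩ := hdir d d'
    have hiff : ∀ {a b}, g d'' a a → g d'' b b → ((⨆ d, g d) a b ↔ g d'' a b) := fun ha hb =>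
      ⟨(hg d'').lin.of_le hlin (hle d'') ha hb, hle d'' _ _⟩
    have h3 := fun i => h1 _ _ (hd i)
    have h4 := fun i => h2 _ _ (hd' i)
    refine (hg d'').ind ν E hE f f' h3 h4 (fun i j => ?_) hEf
    rw [← hiff (h3 i) (h3 j), ← hiff (h4 i) (h4 j)]
    exact hff' i j
  · intro a ha
    obtain ⟨d, hd⟩ := (hsup _ _).1 ha
    exact (hg d).mem a hd
  · have h1 : #{a // (⨆ d, g d) a a} ≤ #(Σ d, {a // g d a a}) := by
      refine Cardinal.mk_le_of_surjective (f := fun p : Σ d, {a // g d a a} =>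
        (⟨p.2.1, hle p.1 _ _ p.2.2⟩ : {a // (⨆ d, g d) a a})) ?_
      rintro ⟨a, ha⟩
      obtain ⟨d, hd⟩ := (hsup _ _).1 ha
      exact ⟨⟨d, a, hd⟩, rfl⟩
    refine h1.trans ?_
    rw [Cardinal.mk_sigma]
    exact (Cardinal.sum_le_mk_mul_iSup _).trans (Cardinal.mul_le_of_le hc hD
      (ciSup_le' fun d => (hg d).card))

theorem mk_coords_le {c : Cardinal.{u}} (hc : ℵ₀ ≤ c) {J : Type u} (hJ : #J ≤ c)
    (a : J → M.Tup σ) : #(M.coords a) ≤ c := by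
  have h1 : #(M.coords a) ≤ #(J × ULift.{u} (Fin m)) := by
    refine Cardinal.mk_le_of_surjective (f := fun p : J × ULift.{u} (Fin m) =>
      (⟨⟨σ p.2.down, a p.1 p.2.down⟩, p.1, p.2.down, rfl⟩ : M.coords a)) ?_
    rintro ⟨_, j, k, rfl⟩
    exact ⟨(j, ⟨k⟩), rfl⟩
  refine h1.trans ?_
  rw [Cardinal.mk_prod, Cardinal.lift_id, Cardinal.lift_id]
  refine Cardinal.mul_le_of_le hc hJ ?_
  simpa using Cardinal.natCast_lt_aleph0.le.trans hc

/-- The insertion of a limit into a small indiscernible sequence. -/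
theorem Str.IsGood.exists_insert {P : ∀ s, Set (M.carrier s)} {c : Cardinal.{u}} (hc : ℵ₀ ≤ c)
    {R : M.Tup σ → M.Tup σ → Prop} (hR : M.IsGood P c R) {n : ℕ}
    {U : Ultrafilter (Fin n → M.Tup σ)}
    (hU : ∀ᶠ f : Fin n → M.Tup σ in U, ∀ i, R (f i) (f i)) {v : Fin n → M.Tup σ}
    (hvP : ∀ i k, v i k ∈ P (σ k)) {A : Set M.Elem}
    (hRA : ∀ (a : M.Tup σ) k, R a a → (⟨σ k, a k⟩ : M.Elem) ∈ A)
    (hv : ∀ ψ : M.FormulaOver A (fun p : Fin n × Fin m => σ p.2),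
      M.Holds ψ (Str.flat v) ↔ ∀ᶠ f in U, M.Holds ψ (Str.flat f)) :
    ∃ R', M.IsGood P c R' ∧ R ≤ R' ∧ (∀ a, R' a a ↔ ∃ c, evalCode (R := R) v c = a) ∧
      (∀ c d : {a // R a a} ⊕ Fin n, R' (evalCode v c) (evalCode v d) ↔
        ∀ᶠ f in U, R (evalCode f c) (evalCode f d)) := by
  obtain ⟨R', hlin, hind, hle, hdom, hR'⟩ := MSLanguage.exists_insert hR.lin hR.ind hU (v := v)
    fun {ν} _ {D} hD c => lim_evalCode (Set.empty_subset A) hRA hv (hD.dfnOver ∅) c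
  refine ⟨R', ⟨hlin, hind, ?_, ?_⟩, hle, hdom, hR'⟩
  · intro a ha k
    obtain ⟨a | i, rfl⟩ := (hdom a).1 ha
    · exact hR.mem _ a.2 k
    · exact hvP i k
  · have h1 : #{a // R' a a} ≤ #({a // R a a} ⊕ ULift.{u} (Fin n)) := by
      refine Cardinal.mk_le_of_surjective (f := fun q : {a // R a a} ⊕ ULift.{u} (Fin n) =>
        (⟨evalCode v (q.map id ULift.down), (hdom _).2 ⟨_, rfl⟩⟩ : {a // R' a a})) ?_
      rintro ⟨a, ha⟩
      obtain ⟨b | i, hb⟩ := (hdom a).1 ha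
      · exact ⟨.inl b, Subtype.ext hb⟩
      · exact ⟨.inr ⟨i⟩, Subtype.ext hb⟩
    refine h1.trans ?_
    rw [Cardinal.mk_sum, Cardinal.lift_id, Cardinal.lift_id]
    refine Cardinal.add_le_of_le hc hR.card ?_
    simpa using Cardinal.natCast_lt_aleph0.le.trans hc

/-- Small indiscernible sequences in the predicate of a saturated pair, whose reduct is a model of
an NIP theory, have the closure properties needed for `IsLimClass.exists_extension`. -/
theorem isLimClass_isGood {T : L.Theory} (hT : T.IsNIP) (hM : M.Models T)
    {P : ∀ s, Set (M.carrier s)} {κ c : Cardinal.{u}} (hκ : (M.pair P).IsSaturated κ)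
    (hcκ : c < κ) (hc : ℵ₀ ≤ c) {B : Set M.Elem} (hB : #B ≤ c)
    (hΔ : #((n : ℕ) × M.FormulaOver B (fun p : Fin n × Fin m => σ p.2)) ≤ c) :
    IsLimClass (Δ := (n : ℕ) × M.FormulaOver B (fun p : Fin n × Fin m => σ p.2))
      (ar := fun δ => δ.1) (fun δ s => M.Holds δ.2 (Str.flat s)) (M.IsGood (σ := σ) P c) where
  lin := fun h => h.lin
  swap := fun h => h.swap
  bdd := fun δ => by
    obtain ⟨K, hK⟩ := exists_jump_bound hT hM δ.2
    exact ⟨K, fun R hR => hK R hR.lin hR.ind⟩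
  chain := fun g hg hch => by
    have : Nonempty (((n : ℕ) × M.FormulaOver B (fun p : Fin n × Fin m => σ p.2)) × ℕ) :=
      ⟨⟨⟨0, .falsum⟩, 0⟩⟩
    refine Str.IsGood.iSup hc ?_ hg hch
    rw [Cardinal.mk_prod, Cardinal.lift_uzero]
    exact Cardinal.mul_le_of_le hc hΔ (by simpa using hc)
  ext := fun R hR U hU => by
    let A : Set M.Elem := M.coords (fun a : {a // R a a} => a.1) ∪ B
    have hA : #A < κ := lt_of_le_of_lt ((Cardinal.mk_union_le _ _).trans
      (Cardinal.add_le_of_le hc (mk_coords_le hc hR.card _) hB)) hcκ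
    have hRA : ∀ (a : M.Tup σ) k, R a a → (⟨σ k, a k⟩ : M.Elem) ∈ A := fun a k ha =>
      Or.inl ⟨⟨a, ha⟩, k, rfl⟩
    let U' : Ultrafilter (Fin 1 → M.Tup σ) := U.map fun z _ => z
    have hU' : ∀ᶠ f : Fin 1 → M.Tup σ in U', ∀ i, R (f i) (f i) := by
      change ∀ᶠ z in U, ∀ i : Fin 1, R z z
      exact hU.mono fun z hz _ => hz
    obtain ⟨w, hwP, hw⟩ := exists_lim hκ hA (ρ := fun p : Fin 1 × Fin m => σ p.2)
      (U'.map Str.flat) (by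
        change ∀ᶠ f in U', ∀ p : Fin 1 × Fin m, Str.flat f p ∈ P (σ p.2)
        exact hU'.mono fun f hf p => hR.mem _ (hf p.1) p.2)
    let v : Fin 1 → M.Tup σ := fun i k => w (i, k)
    have hv : ∀ ψ : M.FormulaOver A (fun p : Fin 1 × Fin m => σ p.2),
        M.Holds ψ (Str.flat v) ↔ ∀ᶠ f in U', M.Holds ψ (Str.flat f) := hw
    obtain ⟨R', hR', hle, hdom, hcode⟩ := hR.exists_insert hc hU' (v := v)
      (fun i k => hwP (i, k)) hRA hv
    refine ⟨v 0, R', hR', hle, fun x => ?_, fun x hx => ?_, fun x hx => ?_, fun δ s hs => ?_⟩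
    · rw [hdom]
      constructor
      · rintro ⟨a | i, rfl⟩
        · exact Or.inl a.2
        · exact Or.inr (by rw [Subsingleton.elim i 0]; rfl)
      · rintro (h | rfl)
        · exact ⟨.inl ⟨x, h⟩, rfl⟩
        · exact ⟨.inr 0, rfl⟩
    · exact hcode (.inl ⟨x, hx⟩) (.inr 0)
    · exact hcode (.inr 0) (.inl ⟨x, hx⟩)
    · classical
      let c' : Fin δ.1 → {a // R a a} ⊕ Fin 1 := fun i =>
        if h : s i = v 0 then .inr 0 else .inl ⟨s i, by
          obtain ⟨a | j, ha⟩ := (hdom _).1 (hs i)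
          · rw [← ha]
            exact a.2
          · exact absurd (by rw [← ha, Subsingleton.elim j 0]; rfl) h⟩
      have h1 : ∀ z, (fun i => evalCode (fun _ : Fin 1 => z) (c' i)) = repl (v 0) z s := by
        intro z
        funext i
        by_cases h : s i = v 0
        · simp [c', h, repl, evalCode]
        · simp [c', h, repl, evalCode]
      have h2 : (fun i => evalCode v (c' i)) = s := by
        have h3 : v = fun _ => v 0 := funext fun i => by rw [Subsingleton.elim i 0]
        rw [h3, h1]
        funext i
        unfold repl
        split_ifs with h
        · exact h.symm
        · rfl
      have h4 := lim_evalCode (Set.subset_union_right : B ⊆ A) hRA hv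
        (D := fun w => M.Holds δ.2 w) ⟨δ.2, fun _ => Iff.rfl⟩ c'
      rw [h2] at h4
      refine h4.trans ?_
      change (∀ᶠ z in U, M.Holds δ.2 (Str.flat fun j => evalCode (fun _ : Fin 1 => z) (c' j))) ↔ _
      simp only [h1]

/-! ### Passage from sequences to orders on sets of tuples -/

/-- The members of a non-constant indiscernible sequence are distinct. -/
theorem Str.IsIndiscernible.injective {I : Type u} [LinearOrder I] {a : I → M.Tup σ}
    (ha : M.IsIndiscernible a) (hnc : ∃ i j, a i ≠ a j) : Function.Injective a := by
  have hD : M.Dfn (fun p : Fin 2 × Fin m => σ p.2) (fun w => ∀ k, w (0, k) = w (1, k)) :=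
    Str.Dfn.forall_finite fun k => Str.Dfn.equal M
      (.var (σ := fun p : Fin 2 × Fin m => σ p.2) (0, k))
      (.var (σ := fun p : Fin 2 × Fin m => σ p.2) (1, k))
  obtain ⟨φ, hφ⟩ := hD
  have hmono : ∀ i j : I, i < j → StrictMono ![i, j] := by
    intro i j hij p q hpq
    fin_cases p <;> fin_cases q <;> simp_all
  have key : ∀ i j i' j' : I, i < j → i' < j' → a i = a j → a i' = a j' := by
    intro i j i' j' h h' he
    have h1 := ha 2 φ _ _ (hmono i j h) (hmono i' j' h')
    rw [hφ, hφ] at h1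
    exact funext (h1.1 fun k => congrFun he k)
  obtain ⟨i₀, j₀, hne⟩ := hnc
  have key' : ∀ i j, i < j → a i ≠ a j := by
    intro i j hij he
    rcases lt_trichotomy i₀ j₀ with h | h | h
    · exact hne (key i j _ _ hij h he)
    · exact hne (by rw [h])
    · exact hne (key i j _ _ hij h he).symm
  intro i j he
  rcases lt_trichotomy i j with h | h | h
  · exact absurd he (key' i j h)
  · exact h
  · exact absurd he.symm (key' j i h)

/-- An indiscernible sequence does not distinguish between finite families of indices of the same
order type; they need not be strictly increasing. -/
theorem Str.IsIndiscernible.of_orderType {I : Type u} [LinearOrder I] {a : I → M.Tup σ}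
    (ha : M.IsIndiscernible a) {ν : Type} [Finite ν]
    {D : (∀ p : ν × Fin m, M.carrier (σ p.2)) → Prop} (hD : M.Dfn (fun p : ν × Fin m => σ p.2) D)
    {f g : ν → I} (hfg : ∀ i j, f i ≤ f j ↔ g i ≤ g j)
    (h : D (Str.flat fun i => a (f i))) : D (Str.flat fun i => a (g i)) := by
  classical
  have := Fintype.ofFinite ν
  let F := Finset.univ.image f
  let e := F.orderIsoOfFin rfl
  let π : ν → Fin F.card := fun i => e.symm ⟨f i, Finset.mem_image_of_mem f (Finset.mem_univ i)⟩
  have hπ : ∀ i, (e (π i) : I) = f i := fun i => by simp [π]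
  have hsurj : Function.Surjective π := by
    intro j
    obtain ⟨i, -, hi⟩ := Finset.mem_image.1 (e j).2
    refine ⟨i, e.injective (Subtype.ext ?_)⟩
    rw [hπ, hi]
  choose sec hsec using hsurj
  have hf : ∀ j, f (sec j) = e j := fun j => by rw [← hπ, hsec]
  have hg : ∀ i, g (sec (π i)) = g i := by
    intro i
    have h1 : f (sec (π i)) = f i := by rw [hf, hπ]
    exact le_antisymm ((hfg _ _).1 h1.le) ((hfg _ _).1 h1.ge)
  have hgm : StrictMono fun j => g (sec j) := by
    intro j j' hjj
    have h1 : f (sec j) < f (sec j') := by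
      rw [hf, hf]
      exact e.strictMono hjj
    refine lt_of_not_ge fun hle => ?_
    exact absurd ((hfg _ _).2 hle) (not_le_of_gt h1)
  have hfm : StrictMono fun j => (e j : I) := fun j j' hjj => e.strictMono hjj
  obtain ⟨φ, hφ⟩ := hD.preimage (ρ := fun p : Fin F.card × Fin m => σ p.2)
    (fun p => .var (σ := fun p : Fin F.card × Fin m => σ p.2) (π p.1, p.2))
  have h1 := ha _ φ _ _ hfm hgm
  rw [hφ, hφ] at h1
  have h2 : (fun i => a (e (π i))) = fun i => a (f i) := funext fun i => by rw [hπ]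
  have h3 : (fun i => a (g (sec (π i)))) = fun i => a (g i) := funext fun i => by rw [hg]
  have h4 : D (Str.flat fun i => a (e (π i))) → D (Str.flat fun i => a (g (sec (π i)))) := h1.1
  rw [h2, h3] at h4
  exact h4 h

/-- The linear order on the set of members of an injective sequence. -/
def seqRel {T I : Type u} [LinearOrder I] (a : I → T) : T → T → Prop :=
  fun x y => ∃ i j, i ≤ j ∧ a i = x ∧ a j = y

theorem seqRel_iff {T I : Type u} [LinearOrder I] {a : I → T} (ha : Function.Injective a)
    {i j : I} : seqRel a (a i) (a j) ↔ i ≤ j := by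
  refine ⟨?_, fun h => ⟨i, j, h, rfl, rfl⟩⟩
  rintro ⟨i', j', h, hi, hj⟩
  rwa [← ha hi, ← ha hj]

theorem isGood_seqRel {P : ∀ s, Set (M.carrier s)} {c : Cardinal.{u}} {I : Type u} [LinearOrder I]
    {a : I → M.Tup σ} (ha : M.IsIndiscernible a) (hinj : Function.Injective a)
    (haP : ∀ i k, a i k ∈ P (σ k)) (hI : #I ≤ c) : M.IsGood P c (seqRel a) := by
  have hdom : ∀ {x}, seqRel a x x → ∃ i, a i = x := fun ⟨i, _, _, hi, _⟩ => ⟨i, hi⟩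
  refine ⟨⟨?_, ?_, ?_, ?_, ?_⟩, ?_, ?_, ?_⟩
  · rintro x y ⟨i, j, h, rfl, rfl⟩
    exact ⟨i, i, le_rfl, rfl, rfl⟩
  · rintro x y ⟨i, j, h, rfl, rfl⟩
    exact ⟨j, j, le_rfl, rfl, rfl⟩
  · rintro x y z ⟨i, j, h, rfl, rfl⟩ ⟨i', j', h', hi', rfl⟩
    exact ⟨i, j', h.trans (hinj hi' ▸ h'), rfl, rfl⟩
  · rintro x y ⟨i, j, h, rfl, rfl⟩ h'
    rw [le_antisymm h ((seqRel_iff hinj).1 h')]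
  · intro x y hx hy
    obtain ⟨i, rfl⟩ := hdom hx
    obtain ⟨j, rfl⟩ := hdom hy
    rw [seqRel_iff hinj, seqRel_iff hinj]
    exact le_total i j
  · intro ν _ D hD f g hf hg hfg h
    choose f' hf' using fun i => hdom (hf i)
    choose g' hg' using fun i => hdom (hg i)
    obtain rfl : (fun i => a (f' i)) = f := funext hf'
    obtain rfl : (fun i => a (g' i)) = g := funext hg'
    simp only [seqRel_iff hinj] at hfg
    exact ha.of_orderType hD hfg h
  · intro x hx k
    obtain ⟨i, rfl⟩ := hdom hx
    exact haP i k
  · refine le_trans (Cardinal.mk_le_of_surjective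
      (f := fun i => (⟨a i, i, i, le_rfl, rfl, rfl⟩ : {x // seqRel a x x})) ?_) hI
    rintro ⟨x, hx⟩
    obtain ⟨i, rfl⟩ := hdom hx
    exact ⟨i, rfl⟩

/-! ### Types over the large model -/

/-- Suppose that, in extensions of `R`, the formula `φ` does not jump between an element and the
members of `R` whose limit it is. If `v` satisfies the limit of types along `U` over the coordinates
of `R`, then `v` also satisfies `φ` exactly if almost all tuples along `U` do, although `φ` may have
other parameters. -/
theorem Str.IsGood.holds_iff_eventually {P : ∀ s, Set (M.carrier s)} {c : Cardinal.{u}}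
    (hc : ℵ₀ ≤ c) {R : M.Tup σ → M.Tup σ → Prop} (hR : M.IsGood P c R) {B : Set M.Elem} {n : ℕ}
    (φ : M.FormulaOver B (fun p : Fin n × Fin m => σ p.2))
    (hφ : ∀ R', M.IsGood P c R' → R ≤ R' → ∀ (v : M.Tup σ) (U : Ultrafilter (M.Tup σ)),
      (∀ᶠ z in U, R z z) → (∀ x, R x x → (R' x v ↔ ∀ᶠ z in U, R x z)) →
      (∀ x, R x x → (R' v x ↔ ∀ᶠ z in U, R z x)) →
      ∀ᶠ z in U, ¬ Jump R' (fun s => M.Holds φ (Str.flat s)) z v ∧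
        ¬ Jump R' (fun s => M.Holds φ (Str.flat s)) v z)
    {U : Ultrafilter (Fin n → M.Tup σ)}
    (hU : ∀ᶠ f : Fin n → M.Tup σ in U, ∀ i, R (f i) (f i)) {v : Fin n → M.Tup σ}
    (hvP : ∀ i k, v i k ∈ P (σ k)) {A : Set M.Elem}
    (hRA : ∀ (a : M.Tup σ) k, R a a → (⟨σ k, a k⟩ : M.Elem) ∈ A)
    (hv : ∀ ψ : M.FormulaOver A (fun p : Fin n × Fin m => σ p.2),
      M.Holds ψ (Str.flat v) ↔ ∀ᶠ f in U, M.Holds ψ (Str.flat f)) :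
    M.Holds φ (Str.flat v) ↔ ∀ᶠ f in U, M.Holds φ (Str.flat f) := by
  obtain ⟨R', hR', hle, hdom, hcode⟩ := hR.exists_insert hc hU hvP hRA hv
  have h1 : ∀ᶠ f : Fin n → M.Tup σ in U, ∀ i,
      ¬ Jump R' (fun s => M.Holds φ (Str.flat s)) (f i) (v i) ∧
        ¬ Jump R' (fun s => M.Holds φ (Str.flat s)) (v i) (f i) := by
    refine eventually_all.2 fun i => ?_
    exact hφ R' hR' hle (v i) (U.map fun f : Fin n → M.Tup σ => f i) (hU.mono fun f hf => hf i)
      (fun x hx => hcode (.inl ⟨x, hx⟩) (.inr i)) (fun x hx => hcode (.inr i) (.inl ⟨x, hx⟩))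
  have h2 : ∀ᶠ f : Fin n → M.Tup σ in U, ∀ i j, R' (f i) (f j) ↔ R' (v i) (v j) := by
    refine eventually_all.2 fun i => eventually_all.2 fun j => ?_
    have h3 : R' (v i) (v j) ↔ ∀ᶠ f : Fin n → M.Tup σ in U, R (f i) (f j) :=
      hcode (.inr i) (.inr j)
    by_cases h : R' (v i) (v j)
    · exact (h3.1 h).mono fun f hf => iff_of_true (hle _ _ hf) h
    · have h4 := h
      rw [h3, ← Ultrafilter.eventually_not] at h4
      filter_upwards [h4, hU] with f hf hf'
      exact iff_of_false (fun hcon => hf (hR.lin.of_le hR'.lin hle (hf' i) (hf' j) hcon)) h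
  have h3 : ∀ᶠ f : Fin n → M.Tup σ in U,
      (M.Holds φ (Str.flat v) ↔ M.Holds φ (Str.flat f)) := by
    filter_upwards [h1, h2, hU] with f hf hf' hf''
    exact (iff_of_not_jump (Φ := fun s => M.Holds φ (Str.flat s)) hR'.lin f
      (fun i => hle _ _ (hf'' i)) v (fun i => (hdom _).2 ⟨.inr i, rfl⟩) hf' hf).symm
  rw [← eventually_congr h3, eventually_const]

/-- The formulas which hold along an ultrafilter form a complete type. -/
theorem isCompleteType_eventually {A : Set M.Elem} {α : Type x} {ρ : α → S} {ι : Type*}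
    (U : Ultrafilter ι) (w : ι → ∀ a, M.carrier (ρ a)) :
    M.IsCompleteType A {ψ : M.FormulaOver A ρ | ∀ᶠ i in U, M.Holds ψ (w i)} := by
  refine ⟨fun p₀ hp hfin => ?_, fun φ => ?_⟩
  · obtain ⟨i, hi⟩ := ((eventually_all_finite hfin).2 fun ψ hψ => hp hψ).exists
    exact ⟨w i, trivial, hi⟩
  · exact or_iff_not_imp_left.2 fun h => Ultrafilter.eventually_not.2 h

/-- A type which is finitely realised in a set is realised along an ultrafilter on this set. -/
theorem exists_ultrafilter_of_finitelyRealisedIn {A : Set M.Elem} {α : Type x} {ρ : α → S}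
    {ι : Type*} {w : ι → ∀ a, M.carrier (ρ a)} {q : Set (M.FormulaOver A ρ)}
    (hq : M.FinitelyRealisedIn q (Set.range w)) :
    ∃ U : Ultrafilter ι, ∀ ψ ∈ q, ∀ᶠ i in U, M.Holds ψ (w i) := by
  classical
  let F : Set (Set ι) := (fun ψ : M.FormulaOver A ρ => {i | M.Holds ψ (w i)}) '' q
  have hF : (generate F).NeBot := by
    rw [generate_neBot_iff]
    intro t ht hfin
    have : Nonempty (M.FormulaOver A ρ) := ⟨.falsum⟩
    choose! g hg hg' using fun x (hx : x ∈ t) => ht hx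
    obtain ⟨_, ⟨i, rfl⟩, hi⟩ := hq (g '' t) (Set.image_subset_iff.2 hg) (hfin.image g)
    refine ⟨i, ?_⟩
    intro x hx
    rw [← hg' x hx]
    exact hi _ ⟨x, hx, rfl⟩
  obtain ⟨U, hU⟩ := Ultrafilter.exists_le (generate F)
  exact ⟨U, fun ψ hψ => hU (mem_generate_of_mem ⟨ψ, hψ, rfl⟩)⟩

/-- A complete type which is contained in the limit of types along `U` is equal to it. -/
theorem holds_iff_eventually_of_realises {A : Set M.Elem} {α : Type x} {ρ : α → S} {ι : Type*}
    {U : Ultrafilter ι} {w : ι → ∀ a, M.carrier (ρ a)} {q : Set (M.FormulaOver A ρ)}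
    (hq : M.IsCompleteType A q) (hU : ∀ ψ ∈ q, ∀ᶠ i in U, M.Holds ψ (w i))
    {v : ∀ a, M.carrier (ρ a)} (hv : M.Realises v q) (ψ : M.FormulaOver A ρ) :
    M.Holds ψ v ↔ ∀ᶠ i in U, M.Holds ψ (w i) := by
  rcases hq.2 ψ with h | h
  · exact iff_of_true (hv _ h) (hU _ h)
  · exact iff_of_false (hv _ h) (Ultrafilter.eventually_not.1 (hU _ h))

theorem mk_formulaOver_le {B : Set M.Elem} {c : Cardinal.{u}} (hc : ℵ₀ ≤ c) (hS : #S ≤ c)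
    (hL : L.card ≤ c) (hB : #B ≤ c) :
    #((n : ℕ) × M.FormulaOver B (fun p : Fin n × Fin m => σ p.2)) ≤ c := by
  rw [Cardinal.mk_sigma]
  refine (Cardinal.sum_le_lift_mk_mul_iSup _).trans (Cardinal.mul_le_of_le hc ?_ ?_)
  · simpa using hc
  · refine ciSup_le' fun n => ?_
    refine mk_formula_le _ hc hS hL ?_
    rw [Cardinal.mk_sum, Cardinal.lift_uzero]
    refine Cardinal.add_le_of_le hc ?_ hB
    simpa using ((Cardinal.natCast_lt_aleph0 (n := n * m)).le.trans hc)

end MSLanguage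

open MSLanguage in
theorem lemma3 {S : Type u} (L : MSLanguage S) (T : L.Theory)
    (hT : T.IsComplete) (hNIP : T.IsNIP)
    -- the model `M` and its saturated elementary extension `N`
    (M N : L.Str) (hM : M.Models T) (ι : ElementaryEmbedding M N)
    (μ : Cardinal.{u}) (hμ : ℵ₀ + #S + L.card + #M.Elem < μ) (hN : N.IsSaturated μ)
    -- the saturated elementary extension `(N', M')` of `(N, M)`
    (N' : L.Str) (M' : ∀ s, Set (N'.carrier s))
    (ι' : ElementaryEmbedding (N.pair ι.range) (N'.pair M'))
    (κ : Cardinal.{u}) (hκ : ℵ₀ + #S + L.card + #N.Elem < κ) (hN' : (N'.pair M').IsSaturated κ)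
    -- the small non-constant indiscernible sequence `A` in `M'`
    {m : ℕ} (σ : Fin m → S) {I : Type u} [LinearOrder I] (A : I → ∀ k, N'.carrier (σ k))
    (hAM' : ∀ i k, A i k ∈ M' (σ k)) (hI : #I < κ) (hA : N'.IsIndiscernible A)
    (hnc : ∃ i j, A i ≠ A j) :
    ∃ (J : Type u) (_ : LinearOrder J) (e : I ↪o J) (A' : J → ∀ k, N'.carrier (σ k)),
      (∀ i, A' (e i) = A i) ∧ (∀ j k, A' j k ∈ M' (σ k)) ∧ #J < κ ∧ N'.IsIndiscernible A' ∧
      ∀ (n : ℕ) (q : Set (N'.FormulaOver (N'.coords A') (fun p : Fin n × Fin m => σ p.2))),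
        N'.IsCompleteType (N'.coords A') q →
        N'.FinitelyRealisedIn q (Set.range fun f : Fin n → J => N'.tuple A' f) →
        ∃ r : Set (N'.FormulaOver (N'.elems ι'.range) (fun p : Fin n × Fin m => σ p.2)),
          N'.IsCompleteType (N'.elems ι'.range) r ∧
          ∀ v : ∀ p : Fin n × Fin m, N'.carrier (σ p.2),
            N'.Realises v q → (∀ p, v p ∈ M' (σ p.2)) → N'.Realises v r := by
  classical
  -- a bound for the number of formulas over `N` and for the lengths of all sequences
  let c : Cardinal.{u} := (ℵ₀ + #S + L.card + #N.Elem) + #I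
  have hκ₀ : ℵ₀ ≤ κ := by
    refine le_trans ?_ hκ.le
    rw [add_assoc, add_assoc]
    exact self_le_add_right _ _
  have hcκ : c < κ := Cardinal.add_lt_of_lt hκ₀ hκ hI
  have hc : ℵ₀ + #S + L.card + #N.Elem ≤ c := self_le_add_right _ _
  have hcN : #N.Elem ≤ c := (self_le_add_left _ _).trans hc
  have hc' : ℵ₀ + #S + L.card ≤ c := (self_le_add_right _ _).trans hc
  have hcL : L.card ≤ c := (self_le_add_left _ _).trans hc'
  have hcS : #S ≤ c := ((self_le_add_left _ _).trans (self_le_add_right _ _)).trans hc'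
  have hc₀ : ℵ₀ ≤ c := ((self_le_add_right _ _).trans (self_le_add_right _ _)).trans hc'
  let B : Set N'.Elem := N'.elems ι'.range
  have hB : #B ≤ c := by
    refine le_trans ?_ hcN
    refine Cardinal.mk_le_of_surjective (f := fun a : N.Elem =>
      (⟨⟨a.1, ι'.toFun a.1 a.2⟩, a.2, rfl⟩ : B)) ?_
    rintro ⟨⟨s, d⟩, h⟩
    obtain ⟨b, rfl⟩ : ∃ b, ι'.toFun s b = d := h
    exact ⟨⟨s, b⟩, rfl⟩
  have hmod : N'.Models T := ElementaryEmbedding.models_of_pair ι' (ι.models hM)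
  have hinj := hA.injective hnc
  have hC := isLimClass_isGood (σ := σ) hNIP hmod hN' hcκ hc₀ hB
    (mk_formulaOver_le hc₀ hcS hcL hB)
  have hG := isGood_seqRel hA hinj hAM' (self_le_add_left _ _ : #I ≤ c)
  have : Nonempty ((n : ℕ) × N'.FormulaOver B (fun p : Fin n × Fin m => σ p.2)) :=
    ⟨⟨0, .falsum⟩⟩
  obtain ⟨R, hle, hR, hlim⟩ := hC.exists_extension hG
  let J := {a : N'.Tup σ // R a a}
  let A' : J → ∀ k, N'.carrier (σ k) := fun a => a.1
  let _ : LinearOrder J :=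
    { le := fun a b => R a.1 b.1
      le_refl := fun a => a.2
      le_trans := fun a b d h h' => hR.lin.trans h h'
      le_antisymm := fun a b h h' => Subtype.ext (hR.lin.antisymm h h')
      le_total := fun a b => hR.lin.total a.2 b.2
      toDecidableLE := Classical.decRel _ }
  have hmem : ∀ i, R (A i) (A i) := fun i => hle _ _ ((seqRel_iff hinj).2 le_rfl)
  let e : I ↪o J :=
    { toFun := fun i => ⟨A i, hmem i⟩
      inj' := fun i j h => hinj (congrArg Subtype.val h)
      map_rel_iff' := fun {i j} =>
        ⟨fun h => (seqRel_iff hinj).1 (hG.lin.of_le hR.lin hle ((seqRel_iff hinj).2 le_rfl)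
          ((seqRel_iff hinj).2 le_rfl) h), fun h => hle _ _ ((seqRel_iff hinj).2 h)⟩ }
  refine ⟨J, inferInstance, e, A', fun i => rfl, fun j => hR.mem _ j.2, hR.card.trans_lt hcκ,
    ?_, ?_⟩
  · have key : ∀ (n : ℕ) (φ : L.Formula (fun p : Fin n × Fin m => σ p.2)) (f g : Fin n → J),
        StrictMono f → StrictMono g → φ.Realize N' (N'.tuple A' f) →
          φ.Realize N' (N'.tuple A' g) := fun n φ f g hf hg h =>
      hR.ind (Fin n) (fun v => φ.Realize N' v) ⟨φ, fun _ => Iff.rfl⟩ (fun i => (f i).1)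
        (fun i => (g i).1) (fun i => (f i).2) (fun i => (g i).2)
        (fun i j => (hf.le_iff_le (a := i) (b := j)).trans hg.le_iff_le.symm) h
    exact fun n φ f g hf hg => ⟨key n φ f g hf hg, key n φ g f hg hf⟩
  · intro n q hq hfin
    obtain ⟨U, hU⟩ := exists_ultrafilter_of_finitelyRealisedIn hfin
    refine ⟨_, isCompleteType_eventually U fun f => N'.tuple A' f, fun v hvq hvM φ hφ => ?_⟩
    have h := hR.holds_iff_eventually hc₀ (B := B) φ
      (fun R' hR' hle' v U h1 h2 h3 => hlim R' hR' hle' v U h1 h2 h3 ⟨n, φ⟩)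
      (U := U.map fun (f : Fin n → J) i => (f i).1)
      (Filter.Eventually.of_forall (f := (U : Filter (Fin n → J))) fun f i => (f i).2)
      (v := fun i k => v (i, k)) (fun i k => hvM (i, k)) (A := N'.coords A')
      (fun a k ha => ⟨⟨a, ha⟩, k, rfl⟩) (holds_iff_eventually_of_realises hq hU hvq)
    exact h.2 hφ
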